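/- Let $k$ be an algebraically closed field of characteristic $0$. Write $(A)$ for the class in $PGL(3,k)$ of $A\in GL(3,k)$, and let matrices act on column vectors $[x,y,z]$. Let $e_1,e_2,e_3$ be the standard basis of $k^3$; $[v_1,v_2,v_3]$ with vectors $v_i$ is the matrix with columns $v_i$, and $\mathrm{ord}$ is the order of an element of $k^*$. Let $P$ be the group of all elements of $PGL(3,k)$ fixing the point $(0,0,1)$, and $L=\{A\in GL(3,k): A[0,0,1]=[0,0,1]\}$. Let $\tau:P\to L$ be the isomorphism $(A)\mapsto A/a_{33}$, and let $\psi:L\to PGL(2,k)$ send $A$ to the class of its upper left $2\times2$ block. For a subgroup $G\le P$ put $G'=\tau(G)$, $G''=G'\cap\ker\psi$ and $H=\psi(G')$. Let $D_{2\nu}$ be the dihedral group of order $2\nu$ (the Klein four-group if $\nu=2$). For a finite subgroup $G\le P$ and $\eta\in k^*$ consider the following list of properties, denoted $(*)$. $(0)$ $G''$ is the cyclic group generated by $\mathrm{diag}[\eta,\eta,1]$, $\mathrm{ord}(\eta)=|G|/|H|$, and $H$ is isomorphic to $A_5$, $S_4$, $A_4$, $D_{2\nu}$ for some $\nu\ge2$,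 or $\mathbb Z_\nu$ for some $\nu\ge1$. $(1)$ If $H$ is isomorphic to $A_5$, $S_4$ or $A_4$, then $|G''|>n$ for every integer $n\ge 11$ with $|G|\ge 6n^2$. $(2)$ If $H\cong D_{2\nu}$ with $\nu\ge2$, then there exist $\alpha,\varepsilon,\theta\in k^*$ such that $$G'=\langle \mathrm{diag}[\alpha\varepsilon,\alpha,1],\ \mathrm{diag}[\eta,\eta,1],\ [\theta e_2,\theta e_1,e_3]\rangle,$$ $\theta=1$ or $\theta^2=\eta$, $\mathrm{ord}(\varepsilon)=\nu$, $\mathrm{ord}(\eta)=|G''|$ and $\alpha^\nu,\alpha^2\varepsilon\in\langle\eta\rangle$. If $|G''|=1$, then moreover $\nu$ is odd, $\alpha=\varepsilon^{(\nu-1)/2}$ and $\theta=1$. With $G'_d=\langle \mathrm{diag}[\alpha\varepsilon,\alpha,1],\mathrm{diag}[\eta,\eta,1]\rangle$, the group $G'$ is the disjoint union of $G'_d$ and $G'_d\,[\theta e_2,\theta e_1,e_3]$, and $|G'_d|=\nu|G''|$. $(3)$ If $H\cong\mathbb Z_\nu$ with $\nu\ge1$, then for every $\varepsilon\in k^*$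 with $\mathrm{ord}(\varepsilon)=\nu$ there exists $\alpha\in k^*$ such that $\alpha^\nu\in\langle\eta\rangle$, $G'=\langle \mathrm{diag}[\alpha\varepsilon,\alpha,1],\mathrm{diag}[\eta,\eta,1]\rangle$ and $|G'|=\nu|G''|$. **Proposition.** (a) Every finite subgroup $G_0$ of $PGL(3,k)$ fixing the point $(0,0,1)$ is conjugate, by an element of $P$, to a subgroup $G$ of $P$ that has, together with some $\eta\in k^*$, the properties $(*)$. (b) Every finite subgroup $\tilde G$ of $PGL(3,k)$ leaving the line $z=0$ invariant is conjugate in $PGL(3,k)$ to $\{(B): ({}^tB)\in G\}$ for some finite subgroup $G$ of $PGL(3,k)$ that fixes the point $(0,0,1)$ and has, together with some $\eta\in k^*$, the properties $(*)$. -/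

import Mathlib

open scoped MatrixGroups LinearAlgebra.Projectivization

namespace PlaneGroups

noncomputable section

variable (k : Type*) [Field k]

/-- The column vector `[0,0,1]`. -/
abbrev e₃ : Fin 3 → k := ![0, 0, 1]

theorem e₃_ne_zero : e₃ k ≠ 0 := fun h => one_ne_zero (α := k) (by simpa using congrFun h 2)

/-- The point `(0,0,1)` of the projective plane. -/
def pointP : ℙ k (Fin 3 → k) := Projectivization.mk k (e₃ k) (e₃_ne_zero k)

/-- The line `z = 0` of the projective plane, as a set of points. -/
def lineZ : Set (ℙ k (Fin 3 → k)) := {p | ∀ v ∈ p.submodule, v 2 = 0}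

/-- The subgroup of `PGL(3,k)` of all projectivities fixing the point `(0,0,1)`. -/
def PGLfix : Subgroup PGL(3, k) := MulAction.stabilizer PGL(3, k) (pointP k)

/-- The subgroup of `GL(3,k)` of all matrices `A` with `A [0,0,1] = [0,0,1]`. -/
def GLfix : Subgroup (GL (Fin 3) k) := MulAction.stabilizer (GL (Fin 3) k) (e₃ k)

variable {k}

theorem mem_GLfix {A : GL (Fin 3) k} :
    A ∈ GLfix k ↔ A.1 0 2 = 0 ∧ A.1 1 2 = 0 ∧ A.1 2 2 = 1 := by
  rw [GLfix, MulAction.mem_stabilizer_iff, Units.smul_def, Matrix.smul_eq_mulVec]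
  constructor
  · intro h
    refine ⟨?_, ?_, ?_⟩
    · simpa [Matrix.mulVec, dotProduct, Fin.sum_univ_three] using congrFun h 0
    · simpa [Matrix.mulVec, dotProduct, Fin.sum_univ_three] using congrFun h 1
    · simpa [Matrix.mulVec, dotProduct, Fin.sum_univ_three] using congrFun h 2
  · rintro ⟨h0, h1, h2⟩
    funext i
    fin_cases i <;> simp [Matrix.mulVec, dotProduct, Fin.sum_univ_three, h0, h1, h2]

theorem mk_mem_PGLfix_iff {A : GL (Fin 3) k} :
    Matrix.ProjGenLinGroup.mk A ∈ PGLfix k ↔ ∃ c : kˣ, c • e₃ k = A • e₃ k := by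
  rw [PGLfix, MulAction.mem_stabilizer_iff, pointP, Projectivization.PGL.mk_smul_mk,
    Projectivization.mk_eq_mk_iff]

theorem mk_mem_PGLfix (A : GLfix k) : Matrix.ProjGenLinGroup.mk (A : GL (Fin 3) k) ∈ PGLfix k :=
  mk_mem_PGLfix_iff.2 ⟨1, by rw [one_smul]; exact (MulAction.mem_stabilizer_iff.1 A.2).symm⟩

/-- The map `A ↦ (A)` from the matrices fixing `[0,0,1]` to the projectivities fixing `(0,0,1)`. -/
def tauInv : GLfix k →* PGLfix k :=
  (Matrix.ProjGenLinGroup.mk.comp (GLfix k).subtype).codRestrict (PGLfix k) mk_mem_PGLfix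

theorem scalar_smul (u : kˣ) (v : Fin 3 → k) :
    Matrix.GeneralLinearGroup.scalar (Fin 3) u • v = u • v := by
  funext i
  simp [Units.smul_def, Matrix.GeneralLinearGroup.scalar]

theorem tauInv_bijective : Function.Bijective (tauInv (k := k)) := by
  constructor
  · intro A B h
    have h' : Matrix.ProjGenLinGroup.mk (A : GL (Fin 3) k) = Matrix.ProjGenLinGroup.mk B.1 :=
      congrArg Subtype.val h
    obtain ⟨u, hu⟩ := Matrix.ProjGenLinGroup.mk_eq_mk_iff.1 h'
    have hA : A.1 • e₃ k = e₃ k := A.2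
    have hB : B.1 • e₃ k = e₃ k := B.2
    rw [← hu, mul_smul, scalar_smul, smul_comm, hA] at hB
    have hu1 : u = 1 := by
      have := congrFun hB 2
      ext
      simpa [Units.smul_def] using this
    apply Subtype.ext
    rw [← hu, hu1, map_one, mul_one]
  · rintro ⟨g, hg⟩
    obtain ⟨A, rfl⟩ := Matrix.ProjGenLinGroup.mk_surjective g
    obtain ⟨c, hc⟩ := mk_mem_PGLfix_iff.1 hg
    refine ⟨⟨A * Matrix.GeneralLinearGroup.scalar (Fin 3) c⁻¹, ?_⟩, ?_⟩
    · rw [GLfix, MulAction.mem_stabilizer_iff, mul_smul, scalar_smul, smul_comm, ← hc,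
        inv_smul_smul]
    · apply Subtype.ext
      exact (Matrix.ProjGenLinGroup.mk_eq_mk_iff.2 ⟨c⁻¹, rfl⟩).symm

/-- The isomorphism `τ` from the projectivities fixing `(0,0,1)` onto the matrices fixing
`[0,0,1]`: it sends `(A)` to `A / a₃₃`. -/
def tau : PGLfix k ≃* GLfix k := (MulEquiv.ofBijective tauInv tauInv_bijective).symm

theorem mk_tau (g : PGLfix k) : Matrix.ProjGenLinGroup.mk (tau g : GL (Fin 3) k) = g.1 :=
  congrArg Subtype.val ((MulEquiv.ofBijective tauInv tauInv_bijective).apply_symm_apply g)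

theorem tau_mk (A : GL (Fin 3) k) (hA : Matrix.ProjGenLinGroup.mk A ∈ PGLfix k) :
    (tau ⟨Matrix.ProjGenLinGroup.mk A, hA⟩ : GL (Fin 3) k).1 = (A.1 2 2)⁻¹ • A.1 := by
  obtain ⟨u, hu⟩ := Matrix.ProjGenLinGroup.mk_eq_mk_iff.1 (mk_tau ⟨_, hA⟩)
  have h := (mem_GLfix.1 (tau ⟨_, hA⟩).2).2.2
  revert hu h
  generalize (tau ⟨Matrix.ProjGenLinGroup.mk A, hA⟩ : GL (Fin 3) k) = T
  intro hu h
  have hAT : A.1 = (u : k) • T.1 := by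
    rw [← hu]
    ext i j
    simp [Matrix.GeneralLinearGroup.scalar, mul_comm]
  rw [hAT, Matrix.smul_apply, h, smul_smul]
  simp

/-- The homomorphism `π` sending a matrix fixing `[0,0,1]` to its upper left `2 × 2` block. -/
def blockHom : GLfix k →* GL (Fin 2) k where
  toFun A :=
    { val := A.1.1.submatrix Fin.castSucc Fin.castSucc
      inv := (A⁻¹).1.1.submatrix Fin.castSucc Fin.castSucc
      val_inv := by
        have h := mem_GLfix.1 A.2
        have hm : A.1.1 * (A⁻¹).1.1 = 1 := by
          rw [← Units.val_mul, ← Subgroup.coe_mul, mul_inv_cancel]; rfl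
        ext i j
        have := congrFun (congrFun hm i.castSucc) j.castSucc
        fin_cases i <;> fin_cases j <;>
          simpa [Matrix.mul_apply, Fin.sum_univ_three, Fin.sum_univ_two, h.1, h.2.1] using this
      inv_val := by
        have h := mem_GLfix.1 (A⁻¹).2
        have hm : (A⁻¹).1.1 * A.1.1 = 1 := by
          rw [← Units.val_mul, ← Subgroup.coe_mul, inv_mul_cancel]; rfl
        ext i j
        have := congrFun (congrFun hm i.castSucc) j.castSucc
        have h0 := h.1
        have h1 := h.2.1
        generalize (A⁻¹).1.1 = B at this h0 h1
        fin_cases i <;> fin_cases j <;>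
          simpa [Matrix.mul_apply, Fin.sum_univ_three, Fin.sum_univ_two, h0, h1] using this }
  map_one' := by
    ext i j
    fin_cases i <;> fin_cases j <;> simp
  map_mul' A B := by
    have h := mem_GLfix.1 A.2
    ext i j
    fin_cases i <;> fin_cases j <;>
      simp [Matrix.mul_apply, Fin.sum_univ_three, Fin.sum_univ_two, h.1, h.2.1]

/-- The homomorphism `ψ = π₂ ∘ π`, where `π₂ : GL(2,k) → PGL(2,k)` is the canonical map. -/
def psi : GLfix k →* PGL(2, k) := Matrix.ProjGenLinGroup.mk.comp blockHom

/-- `G' = τ(G)`, for a subgroup `G` of `PGL(3,k)` whose elements fix `(0,0,1)`. -/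
def lift (G : Subgroup PGL(3, k)) : Subgroup (GLfix k) :=
  (G.subgroupOf (PGLfix k)).map tau.toMonoidHom

/-- `G'' = G' ∩ Ker ψ`. -/
def kerPart (G : Subgroup PGL(3, k)) : Subgroup (GLfix k) := lift G ⊓ psi.ker

/-- `H = ψ(G')`. -/
def image (G : Subgroup PGL(3, k)) : Subgroup PGL(2, k) := (lift G).map psi

/-- The diagonal matrix `diag[a,b,1]`. -/
def diagM (a b : kˣ) : GL (Fin 3) k where
  val := Matrix.diagonal ![(a : k), b, 1]
  inv := Matrix.diagonal ![((a⁻¹ : kˣ) : k), (b⁻¹ : kˣ), 1]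
  val_inv := by
    ext i j
    fin_cases i <;> fin_cases j <;> simp
  inv_val := by
    ext i j
    fin_cases i <;> fin_cases j <;> simp

/-- The matrix `[t e₂, t e₁, e₃]`, given by its columns. -/
def swapM (t : kˣ) : GL (Fin 3) k where
  val := !![0, (t : k), 0; (t : k), 0, 0; 0, 0, 1]
  inv := !![0, ((t⁻¹ : kˣ) : k), 0; ((t⁻¹ : kˣ) : k), 0, 0; 0, 0, 1]
  val_inv := by
    ext i j
    fin_cases i <;> fin_cases j <;> simp [Matrix.mul_apply, Fin.sum_univ_three]
  inv_val := by
    ext i j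
    fin_cases i <;> fin_cases j <;> simp [Matrix.mul_apply, Fin.sum_univ_three]

/-- The group `G'_d` generated by `diag[αε,α,1]` and `diag[η,η,1]`. -/
def diagGroup (α ε η : kˣ) : Subgroup (GL (Fin 3) k) :=
  Subgroup.closure {diagM (α * ε) α, diagM η η}

/-- The transpose of an invertible matrix. -/
def transposeM (B : GL (Fin 3) k) : GL (Fin 3) k where
  val := B.1.transpose
  inv := (B⁻¹).1.transpose
  val_inv := by rw [← Matrix.transpose_mul, ← Units.val_mul, inv_mul_cancel]; simp
  inv_val := by rw [← Matrix.transpose_mul, ← Units.val_mul, mul_inv_cancel]; simp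

/-- The set `{(B) | (ᵗB) ∈ G}`. -/
def transposeSet (G : Subgroup PGL(3, k)) : Set PGL(3, k) :=
  {p | ∃ B : GL (Fin 3) k, Matrix.ProjGenLinGroup.mk B = p ∧
    Matrix.ProjGenLinGroup.mk (transposeM B) ∈ G}

/-- The conjugate `g G g⁻¹`. -/
def conj (g : PGL(3, k)) (G : Subgroup PGL(3, k)) : Subgroup PGL(3, k) :=
  G.map (MulAut.conj g).toMonoidHom

/-- The properties that describe a finite group `G` of projectivities fixing the point `(0,0,1)`.
Here `G' = lift G`, `G'' = kerPart G` and `H = image G`; the groups `G'` and `G''` of matrices are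
compared with explicit groups inside `GL(3,k)`. The matrix `diag[η,η,1]` generates `G''`, and
`DihedralGroup ν` is the dihedral group of order `2ν`. -/
structure NormalForm (G : Subgroup PGL(3, k)) (η : kˣ) : Prop where
  fixes : G ≤ PGLfix k
  kerPart_eq : (kerPart G).map (GLfix k).subtype = Subgroup.zpowers (diagM η η)
  card_eq : orderOf η * Nat.card (image G) = Nat.card G
  image_type :
    Nonempty (image G ≃* alternatingGroup (Fin 5)) ∨
    Nonempty (image G ≃* Equiv.Perm (Fin 4)) ∨
    Nonempty (image G ≃* alternatingGroup (Fin 4)) ∨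
    (∃ ν : ℕ, 2 ≤ ν ∧ Nonempty (image G ≃* DihedralGroup ν)) ∨
    (∃ ν : ℕ, 1 ≤ ν ∧ Nonempty (image G ≃* Multiplicative (ZMod ν)))
  /-- If `H` is `A₅`, `S₄` or `A₄`, then `|G''| > n` provided `|G| ≥ 6n²` and `n ≥ 11`. -/
  polyhedral :
    (Nonempty (image G ≃* alternatingGroup (Fin 5)) ∨
      Nonempty (image G ≃* Equiv.Perm (Fin 4)) ∨
      Nonempty (image G ≃* alternatingGroup (Fin 4))) →
    ∀ n : ℕ, 11 ≤ n → 6 * n ^ 2 ≤ Nat.card G → n < Nat.card (kerPart G)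
  /-- The normal form when `H` is dihedral of order `2ν`. -/
  dihedral : ∀ ν : ℕ, 2 ≤ ν → Nonempty (image G ≃* DihedralGroup ν) →
    ∃ α ε θ : kˣ,
      (lift G).map (GLfix k).subtype =
        Subgroup.closure {diagM (α * ε) α, diagM η η, swapM θ} ∧
      (θ = 1 ∨ θ ^ 2 = η) ∧
      orderOf ε = ν ∧
      orderOf η = Nat.card (kerPart G) ∧
      α ^ ν ∈ Subgroup.zpowers η ∧
      α ^ 2 * ε ∈ Subgroup.zpowers η ∧
      (Nat.card (kerPart G) = 1 → Odd ν ∧ α = ε ^ ((ν - 1) / 2) ∧ θ = 1) ∧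
      ((lift G).map (GLfix k).subtype : Set (GL (Fin 3) k)) =
        (diagGroup α ε η : Set (GL (Fin 3) k)) ∪ (fun x => x * swapM θ) '' diagGroup α ε η ∧
      Disjoint (diagGroup α ε η : Set (GL (Fin 3) k))
        ((fun x => x * swapM θ) '' diagGroup α ε η) ∧
      Nat.card (diagGroup α ε η) = ν * Nat.card (kerPart G)
  /-- The normal form when `H` is cyclic of order `ν`, for any prescribed `ε` of order `ν`. -/
  cyclic : ∀ ν : ℕ, 1 ≤ ν → Nonempty (image G ≃* Multiplicative (ZMod ν)) →
    ∀ ε : kˣ, orderOf ε = ν → ∃ α : kˣ,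
      α ^ ν ∈ Subgroup.zpowers η ∧
      (lift G).map (GLfix k).subtype = diagGroup α ε η ∧
      Nat.card (lift G) = ν * Nat.card (kerPart G)

end

end PlaneGroups

/-! The statement comes down to finite subgroups of `GL(2,k)`. Under `tau` a finite group fixing the
point becomes a finite group of matrices fixing the vector `[0,0,1]`. Averaging their third rows
(the Maschke argument, in `exists_invariant_row`) gives an invariant linear form that is nonzero on
this vector. After conjugation the third row of every matrix is `(0,0,1)`, so the group is the block
embedding of a finite `K ≤ GL(2,k)`.

The scalars in `K` form a finite, hence cyclic, subgroup of `kˣ`, generated by some `η`, and `K`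
modulo these scalars is `H ≤ PGL(2,k)`. In characteristic zero a nontrivial element of finite order
in `PGL(2,k)` is diagonalisable, so it fixes exactly two points of the projective line. The
stabilizer of a point in `H` embeds in `k` by the ratio of eigenvalues and is therefore cyclic.
Klein's count of pairs (element, fixed point) leaves a global fixed point or three orbits with the
signature of a rotation group. In the three sporadic cases the same count, applied to a normal
subgroup, leaves so few possible orders that Sylow theory identifies `H`
(`TwoPointAction.classification`).

If `H` is cyclic, a lift of a generator is diagonalised, and `K` is generated by the lift and the
scalars. If `H` is dihedral, the rotation is diagonalised; the reflection is then antidiagonal, and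
a scalar together with a diagonal conjugation makes its two entries equal (`exists_rescale`). In the
polyhedral cases only `|H| ≤ 60` is needed.

For an invariant line, the contragredient automorphism exchanges the line `z = 0` with the point
`(0,0,1)` and reduces part (b) to part (a). -/

namespace TwoPointAction
open MulAction

/-! ### Orbit counting when every nontrivial element has two fixed points -/

variable {G X : Type*} [Group G] [MulAction G X]

/-- Double count of the pairs `(g, x)` with `g ∈ N` and `g • x = x`: the identity contributes `|X|`
and every other element 2. Allowing a subgroup `N` is what later restricts the orders of normal
subgroups. The additive form avoids subtraction in `ℕ`. -/
theorem sum_card_inf_stabilizer [Finite G] [Fintype X] (h2 : ∀ g : G, g ≠ 1 → Nat.card (fixedBy X g) = 2)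
    (N : Subgroup G) :
    ∑ x : X, Nat.card (N ⊓ stabilizer G x : Subgroup G) + 2 = Nat.card X + 2 * Nat.card N := by
  classical
  have := Fintype.ofFinite G
  have h1 : ∀ x : X, Nat.card (N ⊓ stabilizer G x : Subgroup G) =
      ∑ g : N, if (g : G) • x = x then 1 else 0 := by
    intro x
    rw [Finset.sum_boole, Nat.cast_id, ← Fintype.card_subtype, ← Nat.card_eq_fintype_card]
    refine Nat.card_congr ⟨fun g => ⟨⟨g.1, g.2.1⟩, g.2.2⟩, fun g => ⟨g.1.1, g.1.2, g.2⟩,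
      fun _ => rfl, fun _ => rfl⟩
  have h3 : ∀ g : N, (∑ x : X, if (g : G) • x = x then 1 else 0) = Nat.card (fixedBy X (g : G)) := by
    intro g
    rw [Finset.sum_boole, Nat.cast_id, ← Fintype.card_subtype, ← Nat.card_eq_fintype_card]
    rfl
  simp_rw [h1]
  rw [Finset.sum_comm]
  simp_rw [h3]
  rw [← Finset.add_sum_erase _ _ (Finset.mem_univ (1 : N)),
    Finset.sum_congr rfl (g := fun _ => 2)]
  · rw [Finset.sum_const, Finset.card_erase_of_mem (Finset.mem_univ _), Finset.card_univ,
      ← Nat.card_eq_fintype_card, smul_eq_mul]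
    have : 0 < Nat.card N := Nat.card_pos
    have h4 : Nat.card (fixedBy X ((1 : N) : G)) = Nat.card X := by
      simp [fixedBy_one_eq_univ]
    omega
  · intro g hg
    apply h2
    simpa using hg

theorem sum_eq_sum_orbits [Fintype X] [Fintype (orbitRel.Quotient G X)] (f : X → ℕ)
    (hf : ∀ (g : G) x, f (g • x) = f x) :
    ∑ x : X, f x = ∑ ω : orbitRel.Quotient G X, Nat.card (orbit G ω.out) * f ω.out := by
  classical
  rw [← Finset.sum_fiberwise (g := fun x => (Quotient.mk _ x : orbitRel.Quotient G X))]
  refine Finset.sum_congr rfl fun ω _ => ?_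
  rw [Finset.sum_congr rfl (g := fun _ => f ω.out)]
  · rw [Finset.sum_const, smul_eq_mul, ← Fintype.card_subtype, ← Nat.card_eq_fintype_card]
    congr 1
    refine Nat.card_congr (Equiv.subtypeEquivRight fun x => ?_)
    rw [← orbitRel_apply, ← Quotient.eq (r := orbitRel G X), Quotient.out_eq]
  · intro x hx
    have : orbitRel G X x ω.out := by
      rw [← Quotient.eq (r := orbitRel G X), Quotient.out_eq]
      simpa using hx
    obtain ⟨g, hg⟩ := orbitRel_apply.1 this
    rw [← hg]
    exact hf g _

theorem natCard_orbit_mul_natCard_stabilizer (x : X) :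
    Nat.card (orbit G x) * Nat.card (stabilizer G x) = Nat.card G := by
  rw [mul_comm, ← Nat.card_congr (orbitEquivQuotientStabilizer G x).symm]
  exact (stabilizer G x).card_mul_index

theorem natCard_stabilizer_smul (g : G) (x : X) :
    Nat.card (stabilizer G (g • x)) = Nat.card (stabilizer G x) :=
  Nat.card_congr (stabilizerEquivStabilizer (g := g) (a := x) (b := g • x) rfl).symm.toEquiv

/-- The double count for `N = ⊤`, where the stabilizers along one orbit have orders adding up to
`|G|`. -/
theorem card_orbits [Finite G] [Fintype X] [Fintype (orbitRel.Quotient G X)]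
    (h2 : ∀ g : G, g ≠ 1 → Nat.card (fixedBy X g) = 2) :
    Fintype.card (orbitRel.Quotient G X) * Nat.card G + 2 =
      ∑ ω : orbitRel.Quotient G X, Nat.card (orbit G ω.out) + 2 * Nat.card G := by
  have h := sum_card_inf_stabilizer h2 (⊤ : Subgroup G)
  have h' := sum_eq_sum_orbits (G := G) (X := X) (fun _ => 1) (fun _ _ => rfl)
  simp only [top_inf_eq] at h
  rw [sum_eq_sum_orbits (G := G) _ natCard_stabilizer_smul] at h
  simp only [Finset.sum_const, smul_eq_mul, mul_one, Finset.card_univ] at h'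
  rw [← h', ← Nat.card_eq_fintype_card, ← Nat.card_eq_fintype_card]
  rw [Subgroup.card_top, Finset.sum_congr rfl
    fun ω _ => natCard_orbit_mul_natCard_stabilizer ω.out] at h
  simpa using h

theorem orbit_structure [Finite G] [Fintype X]
    (h2 : ∀ g : G, g ≠ 1 → Nat.card (fixedBy X g) = 2)
    (hne : ∀ x : X, stabilizer G x ≠ ⊥) (hG : 1 < Nat.card G) :
    (∃ x : X, stabilizer G x = ⊤) ∨
    ∃ x : Fin 3 → X, (∀ y, ∃ i, y ∈ orbit G (x i)) ∧
      (∀ f : X → ℕ, (∀ (g : G) y, f (g • y) = f y) →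
        ∑ y, f y = ∑ i, Nat.card (orbit G (x i)) * f (x i)) ∧
      Monotone (fun i => Nat.card (stabilizer G (x i))) ∧
      ∑ i, Nat.card (orbit G (x i)) = Nat.card G + 2 := by
  classical
  have : Fintype (orbitRel.Quotient G X) := Fintype.ofFinite _
  have hc := card_orbits h2
  have hst : ∀ x : X, 2 ≤ Nat.card (stabilizer G x) := fun x =>
    (Subgroup.one_lt_card_iff_ne_bot _).2 (hne x)
  have hs : ∀ x : X, 2 * Nat.card (orbit G x) ≤ Nat.card G := fun x => by
    rw [← natCard_orbit_mul_natCard_stabilizer (G := G) x, mul_comm]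
    exact Nat.mul_le_mul_left _ (hst x)
  have hpos : ∀ x : X, 0 < Nat.card (orbit G x) := fun x => by
    have := natCard_orbit_mul_natCard_stabilizer (G := G) x
    exact Nat.pos_of_ne_zero fun h => by rw [h] at this; omega
  have hub : 2 * ∑ ω : orbitRel.Quotient G X, Nat.card (orbit G ω.out) ≤
      Fintype.card (orbitRel.Quotient G X) * Nat.card G := by
    rw [Finset.mul_sum]
    exact (Finset.sum_le_card_nsmul _ _ _ fun ω _ => hs ω.out).trans (by simp)
  obtain ⟨r, hr⟩ : ∃ r, Fintype.card (orbitRel.Quotient G X) = r := ⟨_, rfl⟩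
  -- Nontrivial stabilizers give orbits of size at most `|G|/2`, so the count forces `(r/2 - 2)|G| +
  -- 2 ≤ 0` and hence `r < 4`. The values 0 and 1 contradict `|G| > 1`.
  have hr3 : r = 2 ∨ r = 3 := by
    rw [hr] at hc hub
    have h1 : r < 4 := by
      by_contra! h4
      nlinarith
    have h0 : r ≠ 0 := by
      rintro rfl
      omega
    have h5 : r ≠ 1 := by
      rintro rfl
      obtain ⟨ω, hω⟩ := Fintype.card_eq_one_iff.1 hr
      have := Finset.single_le_sum (f := fun ω : orbitRel.Quotient G X => Nat.card (orbit G ω.out))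
        (fun _ _ => Nat.zero_le _) (Finset.mem_univ ω)
      have := hpos ω.out
      omega
    omega
  let σ := Fintype.equivFinOfCardEq hr
  -- With two orbits their sizes add up to 2, so each is a single point fixed by `G`. With three,
  -- the orbits are sorted by stabilizer order.
  rcases hr3 with rfl | rfl
  · left
    rw [hr, ← σ.symm.sum_comp, Fin.sum_univ_two] at hc
    refine ⟨(σ.symm 0).out, ?_⟩
    apply Subgroup.eq_top_of_card_eq
    have h := natCard_orbit_mul_natCard_stabilizer (G := G) (σ.symm 0).out
    have h0 := hpos (σ.symm 0).out
    have h1 := hpos (σ.symm 1).out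
    have : Nat.card (orbit G (σ.symm 0).out) = 1 := by omega
    rwa [this, one_mul] at h
  · right
    let e : Fin 3 → ℕ := fun i => Nat.card (stabilizer G (σ.symm i).out)
    let τ : Fin 3 ≃ orbitRel.Quotient G X := (Tuple.sort e).trans σ.symm
    refine ⟨fun i => (τ i).out, fun y => ?_, fun f hf => ?_, Tuple.monotone_sort e, ?_⟩
    · refine ⟨τ.symm (Quotient.mk _ y), ?_⟩
      beta_reduce
      rw [τ.apply_symm_apply, ← orbitRel_apply, ← Quotient.eq (r := orbitRel G X), Quotient.out_eq]
    · rw [sum_eq_sum_orbits f hf]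
      exact (τ.sum_comp fun ω : orbitRel.Quotient G X => Nat.card (orbit G ω.out) * f ω.out).symm
    · rw [τ.sum_comp fun ω : orbitRel.Quotient G X => Nat.card (orbit G ω.out)]
      rw [hr] at hc
      omega

/-- In rational form, `1/e₁ + 1/e₂ + 1/e₃ = 1 + 2/N > 1`; this forces `e₁ = 2`, then `e₂ ≤ 3`, then
`e₃ < 6` when `e₂ = 3`. -/
theorem sphere_signature {N s₁ s₂ s₃ e₁ e₂ e₃ : ℕ} (h₁ : s₁ * e₁ = N) (h₂ : s₂ * e₂ = N)
    (h₃ : s₃ * e₃ = N) (he₁ : 2 ≤ e₁) (h₁₂ : e₁ ≤ e₂) (h₂₃ : e₂ ≤ e₃)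
    (hs : s₁ + s₂ + s₃ = N + 2) :
    (e₁ = 2 ∧ e₂ = 2 ∧ s₃ = 2 ∧ N = 2 * e₃) ∨
    (N = 12 ∧ s₁ = 6 ∧ s₂ = 4 ∧ s₃ = 4 ∧ e₁ = 2 ∧ e₂ = 3 ∧ e₃ = 3) ∨
    (N = 24 ∧ s₁ = 12 ∧ s₂ = 8 ∧ s₃ = 6 ∧ e₁ = 2 ∧ e₂ = 3 ∧ e₃ = 4) ∨
    (N = 60 ∧ s₁ = 30 ∧ s₂ = 20 ∧ s₃ = 12 ∧ e₁ = 2 ∧ e₂ = 3 ∧ e₃ = 5) := by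
  have a₁ : e₁ = 2 := by
    by_contra h
    have : 3 ≤ e₁ := by omega
    nlinarith
  subst a₁
  have a₂ : e₂ = 2 ∨ e₂ = 3 := by
    by_contra h
    have : 4 ≤ e₂ := by omega
    nlinarith
  rcases a₂ with rfl | rfl
  · left
    have : s₃ = 2 := by omega
    subst this
    omega
  · right
    have h6 : 6 * s₃ = N + 12 := by omega
    have h7 : e₃ < 6 := by
      by_contra! h
      nlinarith
    interval_cases e₃ <;> omega

end TwoPointAction

/-! ### Recognising `A₄`, `S₄` and `A₅` from the orders of normal subgroups -/

namespace TwoPointAction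
open MulAction

section Sylow
variable {G : Type*} [Group G] [Finite G] {p : ℕ} [Fact p.Prime]

/-- The kernel of the conjugation action on the Sylow subgroups lies in the normalizer of one of
them, whose index is `n`. Its order times `n` therefore divides `|G|`, and `hker` makes it trivial.
-/
theorem exists_injective_perm_of_card_sylow {n : ℕ} (hn : Nat.card (Sylow p G) = n)
    (hker : ∀ N : Subgroup G, N.Normal → Nat.card N * n ∣ Nat.card G → Nat.card N = 1) :
    ∃ f : G →* Equiv.Perm (Fin n), Function.Injective f := by
  have e : Sylow p G ≃ Fin n := Finite.equivFinOfCardEq hn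
  refine ⟨(e.permCongrHom.toMonoidHom).comp (toPermHom G (Sylow p G)), ?_⟩
  rw [MonoidHom.coe_comp]
  refine e.permCongrHom.injective.comp ?_
  rw [← MonoidHom.ker_eq_bot_iff, ← Subgroup.card_eq_one]
  refine hker _ inferInstance ?_
  let P : Sylow p G := default
  have hle : (toPermHom G (Sylow p G)).ker ≤ Subgroup.normalizer (P : Set G) := fun g hg =>
    Sylow.smul_eq_iff_mem_normalizer.1 (congrArg (fun f : Equiv.Perm (Sylow p G) => f P) hg)
  rw [← hn, P.card_eq_index_normalizer,
    ← (Subgroup.normalizer (P : Set G)).card_mul_index]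
  exact mul_dvd_mul_right (Subgroup.card_dvd_of_le hle) _

omit [Finite G] [Fact p.Prime] in
theorem card_sylow_ne_one {q : ℕ} (hq : ∀ P : Sylow p G, Nat.card P = q)
    (h : ∀ N : Subgroup G, N.Normal → Nat.card N ≠ q) : Nat.card (Sylow p G) ≠ 1 := by
  intro h1
  let P : Sylow p G := default
  have := (Nat.card_eq_one_iff_unique.1 h1).1
  exact h P (Sylow.normal_of_subsingleton P) (hq P)

theorem natCard_sylow {r m : ℕ} (hG : Nat.card G = p ^ r * m) (hm : ¬ p ∣ m) (P : Sylow p G) :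
    Nat.card P = p ^ r := by
  have hp := Fact.out (p := p.Prime)
  have hm0 : m ≠ 0 := by rintro rfl; exact hm (dvd_zero _)
  rw [P.card_eq_multiplicity, hG, Nat.factorization_mul (pow_ne_zero _ hp.ne_zero) hm0,
    hp.factorization_pow, Finsupp.add_apply, Nat.factorization_eq_zero_of_not_dvd hm]
  simp

theorem card_sylow_dvd {r m : ℕ} (hG : Nat.card G = p ^ r * m) (hm : ¬ p ∣ m) :
    Nat.card (Sylow p G) ∣ m := by
  let P : Sylow p G := default
  have hp := Fact.out (p := p.Prime)
  have h := (P : Subgroup G).card_mul_index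
  rw [natCard_sylow hG hm P, hG] at h
  have := Nat.eq_of_mul_eq_mul_left (pow_pos hp.pos r) h
  rw [← this]
  exact P.card_dvd_index

end Sylow

variable {G : Type*} [Group G]

/-- The image has index two in the symmetric group, and the alternating group is the only such
subgroup. -/
theorem nonempty_mulEquiv_alternatingGroup {n : ℕ} (f : G →* Equiv.Perm (Fin n))
    (hf : Function.Injective f) (hG : 2 * Nat.card G = n.factorial) :
    Nonempty (G ≃* alternatingGroup (Fin n)) := by
  have hidx : f.range.index = 2 := by
    have h := f.range.card_mul_index
    rw [Nat.card_congr (f.ofInjective hf).symm.toEquiv, Nat.card_perm, Nat.card_fin, ← hG,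
      mul_comm 2] at h
    have : 0 < n.factorial := n.factorial_pos
    exact Nat.eq_of_mul_eq_mul_left (by omega) h
  exact ⟨(f.ofInjective hf).trans
    (MulEquiv.subgroupCongr (Equiv.Perm.eq_alternatingGroup_of_index_eq_two hidx))⟩

theorem nonempty_mulEquiv_perm {n : ℕ} (f : G →* Equiv.Perm (Fin n))
    (hf : Function.Injective f) (hG : Nat.card G = n.factorial) :
    Nonempty (G ≃* Equiv.Perm (Fin n)) := by
  refine ⟨MulEquiv.ofBijective f ((Nat.bijective_iff_injective_and_card f).2 ⟨hf, ?_⟩)⟩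
  rw [hG, Nat.card_perm, Nat.card_fin]

theorem nonempty_mulEquiv_A4 [Finite G] (hG : Nat.card G = 12)
    (hN : ∀ N : Subgroup G, N.Normal → Nat.card N = 1 ∨ Nat.card N = 4 ∨ Nat.card N = 12) :
    Nonempty (G ≃* alternatingGroup (Fin 4)) := by
  have : Fact (Nat.Prime 3) := ⟨Nat.prime_three⟩
  have hG' : Nat.card G = 3 ^ 1 * 4 := hG
  have h1 : Nat.card (Sylow 3 G) ≠ 1 := card_sylow_ne_one (natCard_sylow hG' (by norm_num))
    fun N hn h => by have := hN N hn; omega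
  have h2 : Nat.card (Sylow 3 G) ∣ 4 := card_sylow_dvd hG' (by norm_num)
  have h3 := card_sylow_modEq_one 3 G
  have h4 : Nat.card (Sylow 3 G) = 4 := by
    have := Nat.le_of_dvd (by norm_num) h2
    unfold Nat.ModEq at h3
    generalize Nat.card (Sylow 3 G) = n at h1 h2 h3 this ⊢
    clear * - h1 h2 h3 this
    interval_cases n <;> omega
  obtain ⟨f, hf⟩ := exists_injective_perm_of_card_sylow h4 fun N _ h => by
    rw [hG, show 12 = 3 * 4 by norm_num, Nat.mul_dvd_mul_iff_right (by norm_num)] at h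
    have := Nat.le_of_dvd (by norm_num) h
    have := hN N ‹_›
    omega
  exact nonempty_mulEquiv_alternatingGroup f hf (by rw [hG]; rfl)

theorem nonempty_mulEquiv_S4 [Finite G] (hG : Nat.card G = 24)
    (hN : ∀ N : Subgroup G, N.Normal →
      Nat.card N = 1 ∨ Nat.card N = 4 ∨ Nat.card N = 12 ∨ Nat.card N = 24) :
    Nonempty (G ≃* Equiv.Perm (Fin 4)) := by
  have : Fact (Nat.Prime 3) := ⟨Nat.prime_three⟩
  have hG' : Nat.card G = 3 ^ 1 * 8 := hG
  have h1 : Nat.card (Sylow 3 G) ≠ 1 := card_sylow_ne_one (natCard_sylow hG' (by norm_num))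
    fun N hn h => by have := hN N hn; omega
  have h2 : Nat.card (Sylow 3 G) ∣ 8 := card_sylow_dvd hG' (by norm_num)
  have h3 := card_sylow_modEq_one 3 G
  have h4 : Nat.card (Sylow 3 G) = 4 := by
    have := Nat.le_of_dvd (by norm_num) h2
    unfold Nat.ModEq at h3
    generalize Nat.card (Sylow 3 G) = n at h1 h2 h3 this ⊢
    clear * - h1 h2 h3 this
    interval_cases n <;> omega
  obtain ⟨f, hf⟩ := exists_injective_perm_of_card_sylow h4 fun N hn h => by
    rw [hG, show 24 = 6 * 4 by norm_num, Nat.mul_dvd_mul_iff_right (by norm_num)] at h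
    have h6 := Nat.le_of_dvd (by norm_num) h
    rcases hN N hn with h' | h' | h' | h' <;> rw [h'] at h h6 ⊢ <;> revert h h6 <;> decide
  exact nonempty_mulEquiv_perm f hf (by rw [hG]; rfl)

theorem nonempty_mulEquiv_A5 [Finite G] (hG : Nat.card G = 60)
    (hN : ∀ N : Subgroup G, N.Normal → Nat.card N = 1 ∨ Nat.card N = 60) :
    Nonempty (G ≃* alternatingGroup (Fin 5)) := by
  have : Fact (Nat.Prime 2) := ⟨Nat.prime_two⟩
  have hG' : Nat.card G = 2 ^ 2 * 15 := hG
  have hP := natCard_sylow hG' (by norm_num)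
  have h1 : Nat.card (Sylow 2 G) ≠ 1 := card_sylow_ne_one hP
    fun N hn h => by have := hN N hn; omega
  have h2 : Nat.card (Sylow 2 G) ∣ 15 := card_sylow_dvd hG' (by norm_num)
  have hker : ∀ n, 2 ≤ n → ∀ N : Subgroup G, N.Normal → Nat.card N * n ∣ Nat.card G →
      Nat.card N = 1 := by
    intro n h2n N hn h
    have := Nat.le_of_dvd Nat.card_pos h
    rcases hN N hn with h' | h'
    · exact h'
    · rw [h', hG] at this
      omega
  have h3 : Nat.card (Sylow 2 G) ≠ 3 := by
    intro h3
    obtain ⟨f, hf⟩ := exists_injective_perm_of_card_sylow h3 (hker 3 (by norm_num))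
    have := Nat.card_le_card_of_injective f hf
    rw [hG, Nat.card_perm, Nat.card_fin] at this
    revert this
    decide
  -- With 15 Sylow subgroups, `P` would be its own normalizer. As a group of order 4 it is abelian,
  -- so Burnside's transfer theorem would give a normal complement of order 15, which `hN` excludes.
  have h15 : Nat.card (Sylow 2 G) ≠ 15 := by
    intro h15
    let P : Sylow 2 G := default
    have hidx := (Subgroup.normalizer (P : Set G)).card_mul_index
    rw [← P.card_eq_index_normalizer, h15, hG] at hidx
    have hPn : (P : Subgroup G) = Subgroup.normalizer (P : Set G) := by
      refine Subgroup.eq_of_le_of_card_ge Subgroup.le_normalizer ?_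
      rw [hP P]
      omega
    have hcomm : ∀ a b : P, a * b = b * a := (IsPGroup.isMulCommutative_of_card_eq_prime_sq (hP P)).is_comm.comm
    have hc : Subgroup.normalizer (P : Set G) ≤ Subgroup.centralizer (P : Set G) := by
      rw [← hPn]
      intro a ha b hb
      exact congrArg Subtype.val (hcomm ⟨b, hb⟩ ⟨a, ha⟩)
    have h := (MonoidHom.ker_transferSylow_isComplement' P hc).card_mul_card
    rw [hG, hP P] at h
    have := hN (MonoidHom.transferSylow P hc).ker inferInstance
    omega
  have h5 : Nat.card (Sylow 2 G) = 5 := by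
    have := Nat.le_of_dvd (by norm_num) h2
    generalize Nat.card (Sylow 2 G) = n at h1 h2 h3 h15 this ⊢
    clear * - h1 h2 h3 h15 this
    interval_cases n <;> omega
  obtain ⟨f, hf⟩ := exists_injective_perm_of_card_sylow h5 (hker 5 (by norm_num))
  exact nonempty_mulEquiv_alternatingGroup f hf (by rw [hG]; rfl)

end TwoPointAction

/-! ### Dihedral groups and the classification of rotation groups -/

namespace TwoPointAction
open MulAction

/-- For `s` outside `C`, both `s` and `s * c ^ j` square to 1, so `s` inverts `C`; this is the
dihedral relation. -/
theorem nonempty_mulEquiv_dihedralGroup {G : Type*} [Group G] [Finite G] {m : ℕ}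
    (hG : Nat.card G = 2 * m) (C : Subgroup G) [IsCyclic C] (hC : Nat.card C = m)
    (hinv : ∀ g, g ∉ C → g * g = 1) : Nonempty (G ≃* DihedralGroup m) := by
  have hm : 0 < m := hC ▸ Nat.card_pos
  have : NeZero m := ⟨hm.ne'⟩
  obtain ⟨⟨c, hcC⟩, hc⟩ := IsCyclic.exists_generator (α := C)
  have hoc : orderOf c = m := by
    rw [← hC, ← orderOf_eq_card_of_forall_mem_zpowers hc, ← Subgroup.orderOf_coe]
  have hidx : C.index = 2 := by
    have h := C.card_mul_index
    rw [hC, hG, mul_comm 2] at h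
    exact Nat.eq_of_mul_eq_mul_left hm h
  obtain ⟨s, hs⟩ : ∃ s, s ∉ C := by
    by_contra! h
    rw [(Subgroup.eq_top_iff' C).2 h] at hidx
    simp at hidx
  have hss := hinv s hs
  have hsc : ∀ j : ℤ, c ^ j * s = s * c ^ (-j) := by
    intro j
    have h1 := hinv (s * c ^ j) fun h => hs ((C.mul_mem_cancel_right (C.zpow_mem hcC j)).1 h)
    have h2 : s⁻¹ = s := inv_eq_of_mul_eq_one_left hss
    calc c ^ j * s = s⁻¹ * (s * c ^ j * (s * c ^ j)) * (c ^ j)⁻¹ := by group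
      _ = s * c ^ (-j) := by rw [h1, h2, zpow_neg, mul_one]
  have hz : ∀ i j : ZMod m, c ^ ((i + j).val : ℤ) = c ^ (i.val : ℤ) * c ^ (j.val : ℤ) := by
    intro i j
    rw [← zpow_add, ← orderOf_dvd_sub_iff_zpow_eq_zpow, hoc, ← ZMod.intCast_zmod_eq_zero_iff_dvd]
    simp
  have hzn : ∀ i : ZMod m, c ^ ((-i).val : ℤ) = c ^ (-(i.val : ℤ)) := by
    intro i
    rw [zpow_neg, eq_inv_iff_mul_eq_one, ← hz, neg_add_cancel]
    simp
  let f : DihedralGroup m → G := fun x => match x with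
    | .r i => c ^ (i.val : ℤ)
    | .sr i => s * c ^ (i.val : ℤ)
  let F : DihedralGroup m →* G := MonoidHom.mk' f (by
    rintro (i | i) (j | j)
    · exact hz i j
    · change s * c ^ ((j - i).val : ℤ) = c ^ (i.val : ℤ) * (s * c ^ (j.val : ℤ))
      rw [← mul_assoc, hsc, mul_assoc, sub_eq_neg_add, hz, hzn]
    · change s * c ^ ((i + j).val : ℤ) = s * c ^ (i.val : ℤ) * c ^ (j.val : ℤ)
      rw [mul_assoc, hz]
    · change c ^ ((j - i).val : ℤ) = s * c ^ (i.val : ℤ) * (s * c ^ (j.val : ℤ))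
      rw [mul_assoc, ← mul_assoc (c ^ _) s, hsc, ← mul_assoc, ← mul_assoc, hss, one_mul,
        sub_eq_neg_add, hz, hzn])
  have hF : Function.Injective F := by
    rw [injective_iff_map_eq_one]
    rintro (i | i) h
    · change c ^ (i.val : ℤ) = 1 at h
      rw [← orderOf_dvd_iff_zpow_eq_one, hoc, Int.natCast_dvd_natCast] at h
      rw [(ZMod.val_eq_zero i).1 (Nat.eq_zero_of_dvd_of_lt h (ZMod.val_lt i))]
      rfl
    · change s * c ^ (i.val : ℤ) = 1 at h
      exact absurd (eq_inv_of_mul_eq_one_left h ▸ C.inv_mem (C.zpow_mem hcC _)) hs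
  exact ⟨(MulEquiv.ofBijective F ((Nat.bijective_iff_injective_and_card F).2
    ⟨hF, by rw [hG, DihedralGroup.nat_card]⟩)).symm⟩

variable {G X : Type*} [Group G] [MulAction G X]

theorem natCard_inf_stabilizer_smul (N : Subgroup G) [N.Normal] (g : G) (x : X) :
    Nat.card (N ⊓ stabilizer G (g • x) : Subgroup G) =
      Nat.card (N ⊓ stabilizer G x : Subgroup G) := by
  have h : N ⊓ stabilizer G (g • x) = (N ⊓ stabilizer G x).map (MulAut.conj g).toMonoidHom := by
    rw [Subgroup.map_inf _ _ _ (MulAut.conj g).injective,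
      ← stabilizer_smul_eq_stabilizer_map_conj]
    congr 1
    exact (Subgroup.Normal.map_conj_eq N g).symm
  rw [h]
  exact Nat.card_congr (Subgroup.equivMapOfInjective _ _ (MulAut.conj g).injective).symm.toEquiv

/-- A finite group acting on a finite set such that each nontrivial element has exactly two fixed
points, and all point stabilizers are cyclic and nontrivial, is one of the finite rotation
groups. -/
theorem classification [Finite G] [Finite X]
    (h2 : ∀ g : G, g ≠ 1 → Nat.card (fixedBy X g) = 2)
    (hne : ∀ x : X, stabilizer G x ≠ ⊥) (hcyc : ∀ x : X, IsCyclic (stabilizer G x)) :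
    Nonempty (G ≃* alternatingGroup (Fin 5)) ∨ Nonempty (G ≃* Equiv.Perm (Fin 4)) ∨
    Nonempty (G ≃* alternatingGroup (Fin 4)) ∨
    (∃ ν : ℕ, 2 ≤ ν ∧ Nonempty (G ≃* DihedralGroup ν)) ∨ IsCyclic G := by
  rcases (Nat.one_le_iff_ne_zero.2 (Nat.card_pos (α := G)).ne').eq_or_lt with h1 | h1
  · have := (Nat.card_eq_one_iff_unique.1 h1.symm).1
    exact .inr (.inr (.inr (.inr inferInstance)))
  have := Fintype.ofFinite X
  obtain ⟨x, hx⟩ | ⟨x, hcov, hsum, hmono, hs⟩ := orbit_structure h2 hne h1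
  · have := hcyc x
    rw [hx] at this
    exact .inr (.inr (.inr (.inr (isCyclic_of_injective (Subgroup.topEquiv (G := G)).symm.toMonoidHom
      (MulEquiv.injective _)))))
  have hst : ∀ x : X, 2 ≤ Nat.card (stabilizer G x) := fun x =>
    (Subgroup.one_lt_card_iff_ne_bot _).2 (hne x)
  -- For normal `N` the order of `N ⊓ stabilizer` is constant along each orbit, so the double count
  -- becomes an equation in three divisors `n i` of the stabilizer orders and `|N|`. In the sporadic
  -- cases it leaves only the orders of normal subgroups that the Sylow arguments need.
  have hN : ∀ N : Subgroup G, N.Normal → ∃ n : Fin 3 → ℕ,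
      (∀ i, n i ∣ Nat.card (stabilizer G (x i))) ∧
      ∑ i, Nat.card (orbit G (x i)) * n i + 2 =
        ∑ i, Nat.card (orbit G (x i)) + 2 * Nat.card N := by
    intro N hn
    refine ⟨fun i => Nat.card (N ⊓ stabilizer G (x i) : Subgroup G), fun i =>
      Subgroup.card_dvd_of_le inf_le_right, ?_⟩
    have h := sum_card_inf_stabilizer h2 N
    rw [hsum _ (natCard_inf_stabilizer_smul N)] at h
    have h' := hsum (fun _ => 1) fun _ _ => rfl
    simp only [Finset.sum_const, smul_eq_mul, mul_one, Finset.card_univ] at h'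
    rw [h, ← h', Nat.card_eq_fintype_card]
  have hNd : ∀ N : Subgroup G, Nat.card N ∣ Nat.card G := fun N => N.card_subgroup_dvd_card
  have hos := fun i => natCard_orbit_mul_natCard_stabilizer (G := G) (x i)
  simp only [Fin.sum_univ_three] at hs hN
  obtain ⟨e0, e1, s2, hG⟩ | ⟨hG, s0, s1, s2, e0, e1, e2⟩ | ⟨hG, s0, s1, s2, e0, e1, e2⟩ |
    ⟨hG, s0, s1, s2, e0, e1, e2⟩ := sphere_signature (hos 0) (hos 1) (hos 2) (hst _)
    (hmono (show (0 : Fin 3) ≤ 1 by decide)) (hmono (show (1 : Fin 3) ≤ 2 by decide)) hs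
  · refine .inr (.inr (.inr (.inl ⟨_, hst (x 2), ?_⟩)))
    have := hcyc (x 2)
    refine nonempty_mulEquiv_dihedralGroup hG (stabilizer G (x 2)) rfl fun g hg => ?_
    have hg1 : g ≠ 1 := by
      rintro rfl
      exact hg (one_mem _)
    have hf := h2 g hg1
    obtain ⟨⟨y, hy⟩⟩ : Nonempty (fixedBy X g) := (Nat.card_pos_iff.1 (by omega)).1
    have hy' : g ∈ stabilizer G y := hy
    have key : Nat.card (stabilizer G y) = 2 → g * g = 1 := by
      intro h
      have := pow_card_eq_one' (G := stabilizer G y) (x := ⟨g, hy'⟩)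
      rw [h] at this
      simpa [Subtype.ext_iff, pow_two] using this
    obtain ⟨i, h, hgy⟩ := hcov y
    simp only at hgy
    fin_cases i
    · exact key (by rw [← hgy]; exact (natCard_stabilizer_smul h _).trans e0)
    · exact key (by rw [← hgy]; exact (natCard_stabilizer_smul h _).trans e1)
    -- The third orbit has two points, so its stabilizers have index two, are normal and coincide.
    -- An element outside that subgroup cannot fix a point of this orbit.
    · exfalso
      have hidx : (stabilizer G (x 2)).index = 2 := by
        rw [index_stabilizer]
        exact s2
      have := Subgroup.normal_of_index_eq_two hidx
      apply hg
      rw [← hgy] at hy'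
      change g ∈ stabilizer G (h • x 2) at hy'
      rw [stabilizer_smul_eq_stabilizer_map_conj] at hy'
      exact (Subgroup.Normal.map_conj_eq (stabilizer G (x 2)) h).le hy'
  · refine .inr (.inr (.inl (nonempty_mulEquiv_A4 hG fun N hn => ?_)))
    obtain ⟨n, hd, h⟩ := hN N hn
    have hd0 := hd 0
    have hd1 := hd 1
    have hd2 := hd 2
    have hd' := hNd N
    rw [e0, Nat.dvd_prime Nat.prime_two] at hd0
    rw [e1, Nat.dvd_prime Nat.prime_three] at hd1
    rw [e2, Nat.dvd_prime Nat.prime_three] at hd2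
    rw [s0, s1, s2] at h
    rw [hG] at hd'
    have hd' : Nat.card N ∈ Nat.divisors 12 := Nat.mem_divisors.2 ⟨hd', by norm_num⟩
    rw [show Nat.divisors 12 = {1, 2, 3, 4, 6, 12} by decide] at hd'
    simp only [Finset.mem_insert, Finset.mem_singleton] at hd'
    rcases hd0 with a | a <;> rcases hd1 with b | b <;> rcases hd2 with c | c <;>
      rw [a, b, c] at h <;> obtain ⟨q, hq⟩ : ∃ q, q = Nat.card N := ⟨_, rfl⟩ <;>
      rw [← hq] at h hd' ⊢ <;> clear * - h hd' <;> omega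
  · refine .inr (.inl (nonempty_mulEquiv_S4 hG fun N hn => ?_))
    obtain ⟨n, hd, h⟩ := hN N hn
    have hd0 := hd 0
    have hd1 := hd 1
    have hd2 := hd 2
    have hd' := hNd N
    rw [e0, Nat.dvd_prime Nat.prime_two] at hd0
    rw [e1, Nat.dvd_prime Nat.prime_three] at hd1
    rw [e2] at hd2
    have hd2 : n 2 = 1 ∨ n 2 = 2 ∨ n 2 = 4 := by
      have := Nat.le_of_dvd (by norm_num) hd2
      generalize n 2 = m at hd2 this ⊢
      clear * - hd2 this
      interval_cases m <;> omega
    rw [s0, s1, s2] at h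
    rw [hG] at hd'
    have hd' : Nat.card N ∈ Nat.divisors 24 := Nat.mem_divisors.2 ⟨hd', by norm_num⟩
    rw [show Nat.divisors 24 = {1, 2, 3, 4, 6, 8, 12, 24} by decide] at hd'
    simp only [Finset.mem_insert, Finset.mem_singleton] at hd'
    rcases hd0 with a | a <;> rcases hd1 with b | b <;> rcases hd2 with c | c | c <;>
      rw [a, b, c] at h <;> obtain ⟨q, hq⟩ : ∃ q, q = Nat.card N := ⟨_, rfl⟩ <;>
      rw [← hq] at h hd' ⊢ <;> clear * - h hd' <;> omega
  · refine .inl (nonempty_mulEquiv_A5 hG fun N hn => ?_)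
    obtain ⟨n, hd, h⟩ := hN N hn
    have hd0 := hd 0
    have hd1 := hd 1
    have hd2 := hd 2
    have hd' := hNd N
    rw [e0, Nat.dvd_prime Nat.prime_two] at hd0
    rw [e1, Nat.dvd_prime Nat.prime_three] at hd1
    rw [e2, Nat.dvd_prime Nat.prime_five] at hd2
    rw [s0, s1, s2] at h
    rw [hG] at hd'
    have hd' : Nat.card N ∈ Nat.divisors 60 := Nat.mem_divisors.2 ⟨hd', by norm_num⟩
    rw [show Nat.divisors 60 = {1, 2, 3, 4, 5, 6, 10, 12, 15, 20, 30, 60} by decide] at hd'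
    simp only [Finset.mem_insert, Finset.mem_singleton] at hd'
    rcases hd0 with a | a <;> rcases hd1 with b | b <;> rcases hd2 with c | c <;>
      rw [a, b, c] at h <;> obtain ⟨q, hq⟩ : ∃ q, q = Nat.card N := ⟨_, rfl⟩ <;>
      rw [← hq] at h hd' ⊢ <;> clear * - h hd' <;> omega

end TwoPointAction

namespace TwoPointAction
open MulAction

variable {G X : Type*} [Group G] [MulAction G X]

variable (G X) in
/-- The points with nontrivial stabilizer. -/
def nonfreePoints : SubMulAction G X where
  carrier := {x | stabilizer G x ≠ ⊥}
  smul_mem' g x hx := by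
    rw [Set.mem_ofPred_eq, stabilizer_smul_eq_stabilizer_map_conj, Ne,
      Subgroup.map_eq_bot_iff_of_injective _ (MulAut.conj g).injective]
    exact hx

/-- Points with trivial stabilizer are discarded. The others form a finite union of two-point fixed
sets, and every fixed point of a nontrivial element is kept. -/
theorem classification_of_fixedBy [Finite G] (h2 : ∀ g : G, g ≠ 1 → Nat.card (fixedBy X g) = 2)
    (hcyc : ∀ x : X, IsCyclic (stabilizer G x)) :
    Nonempty (G ≃* alternatingGroup (Fin 5)) ∨ Nonempty (G ≃* Equiv.Perm (Fin 4)) ∨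
    Nonempty (G ≃* alternatingGroup (Fin 4)) ∨
    (∃ ν : ℕ, 2 ≤ ν ∧ Nonempty (G ≃* DihedralGroup ν)) ∨ IsCyclic G := by
  have hmem : ∀ (g : G) (x : X), g ≠ 1 → g • x = x → x ∈ nonfreePoints G X := by
    intro g x hg hx h
    have : g ∈ stabilizer G x := hx
    rw [h] at this
    exact hg (Subgroup.mem_bot.1 this)
  have hfin : Finite (nonfreePoints G X) := by
    have : (⋃ g : {g : G // g ≠ 1}, fixedBy X (g : G)).Finite :=
      Set.finite_iUnion fun g => (Nat.card_pos_iff.1 (by rw [h2 g.1 g.2]; norm_num)).2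
    refine this.subset fun x hx => ?_
    have hx' : stabilizer G x ≠ ⊥ := hx
    obtain ⟨g, hg⟩ := Subgroup.ne_bot_iff_exists_ne_one.1 hx'
    exact Set.mem_iUnion.2 ⟨⟨g, fun h => hg (Subtype.ext h)⟩, g.2⟩
  refine classification (X := nonfreePoints G X) (fun g hg => ?_) (fun x => ?_) (fun x => ?_)
  · rw [← h2 g hg]
    refine Nat.card_congr ⟨fun x => ⟨x.1.1, congrArg Subtype.val x.2⟩,
      fun x => ⟨⟨x.1, hmem g x.1 hg x.2⟩, Subtype.ext x.2⟩, fun _ => rfl, fun _ => rfl⟩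
  · rw [SubMulAction.stabilizer_of_subMul]
    exact x.2
  · rw [SubMulAction.stabilizer_of_subMul]
    exact hcyc x.1

end TwoPointAction

/-! ### Diagonalising elements of finite order in `PGL(2,k)` -/

namespace PlaneGroups
open Matrix.ProjGenLinGroup

variable {k : Type*} [Field k]

/-- The diagonal matrix `diag[a,b]`. -/
def diag2 (a b : kˣ) : GL (Fin 2) k where
  val := Matrix.diagonal ![(a : k), b]
  inv := Matrix.diagonal ![((a⁻¹ : kˣ) : k), (b⁻¹ : kˣ)]
  val_inv := by
    ext i j
    fin_cases i <;> fin_cases j <;> simp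
  inv_val := by
    ext i j
    fin_cases i <;> fin_cases j <;> simp

/-- The matrix `[t e₂, t e₁]`. -/
def swap2 (t : kˣ) : GL (Fin 2) k where
  val := !![0, (t : k); (t : k), 0]
  inv := !![0, ((t⁻¹ : kˣ) : k); ((t⁻¹ : kˣ) : k), 0]
  val_inv := by
    ext i j
    fin_cases i <;> fin_cases j <;> simp [Matrix.mul_apply, Fin.sum_univ_two]
  inv_val := by
    ext i j
    fin_cases i <;> fin_cases j <;> simp [Matrix.mul_apply, Fin.sum_univ_two]

theorem diag2_self (a : kˣ) : diag2 a a = Matrix.GeneralLinearGroup.scalar (Fin 2) a := by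
  ext i j
  fin_cases i <;> fin_cases j <;> simp [diag2]

theorem mk_diag2_self (a : kˣ) : mk (diag2 a a) = 1 := by
  rw [diag2_self, mk_scalar]

theorem mk_eq_one_iff {A : GL (Fin 2) k} : mk A = 1 ↔ ∃ a, A = diag2 a a := by
  constructor
  · intro h
    obtain ⟨u, hu⟩ := mk_eq_mk_iff.1 ((map_one mk).trans h.symm)
    exact ⟨u, by rw [← hu, one_mul, diag2_self]⟩
  · rintro ⟨a, rfl⟩
    exact mk_diag2_self a

/-- The matrix with rows `(a,b)` and `(0,d)`. -/
def upper2 (a d : kˣ) (b : k) : GL (Fin 2) k :=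
  Matrix.GeneralLinearGroup.mkOfDetNeZero !![(a : k), b; 0, (d : k)] (by simp)

theorem coe_upper2 (a d : kˣ) (b : k) : (upper2 a d b).1 = !![(a : k), b; 0, (d : k)] := rfl

/-- The eigenvector is completed to a basis, whose vectors are the columns of `P`. -/
theorem exists_conj_upper2 (A : GL (Fin 2) k) {v : Fin 2 → k} (hv : v ≠ 0) {a : k}
    (h : A.1.mulVec v = a • v) :
    ∃ (P : GL (Fin 2) k) (a' d : kˣ) (b : k), (a' : k) = a ∧ A = P * upper2 a' d b * P⁻¹ := by
  have h0 := congrFun h 0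
  have h1 := congrFun h 1
  simp only [Matrix.mulVec, dotProduct, Fin.sum_univ_two, Pi.smul_apply, smul_eq_mul] at h0 h1
  obtain ⟨w, hw⟩ : ∃ w : Fin 2 → k, v 0 * w 1 - w 0 * v 1 ≠ 0 := by
    by_cases hv0 : v 0 = 0
    · refine ⟨![1, 0], fun h => hv ?_⟩
      funext i
      fin_cases i
      · exact hv0
      · simpa [hv0] using h
    · exact ⟨![0, 1], by simpa using hv0⟩
  let P : GL (Fin 2) k := Matrix.GeneralLinearGroup.mkOfDetNeZero !![v 0, w 0; v 1, w 1]
    (by simpa [Matrix.det_fin_two] using hw)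
  obtain ⟨B, hB⟩ : ∃ B, B = P⁻¹ * A * P := ⟨_, rfl⟩
  have e : P.1 * B.1 = A.1 * P.1 := congrArg Units.val (by rw [hB]; group : P * B = A * P)
  have e0 : v 0 * B.1 0 0 + w 0 * B.1 1 0 = A.1 0 0 * v 0 + A.1 0 1 * v 1 := by
    simpa [Matrix.mul_apply, Fin.sum_univ_two, P] using congrFun (congrFun e 0) 0
  have e1 : v 1 * B.1 0 0 + w 1 * B.1 1 0 = A.1 1 0 * v 0 + A.1 1 1 * v 1 := by
    simpa [Matrix.mul_apply, Fin.sum_univ_two, P] using congrFun (congrFun e 1) 0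
  rw [h0] at e0
  rw [h1] at e1
  have b10 : B.1 1 0 = 0 := by
    refine (mul_eq_zero.1 ?_).resolve_left hw
    linear_combination v 0 * e1 - v 1 * e0
  have b00 : B.1 0 0 = a := by
    refine sub_eq_zero.1 ((mul_eq_zero.1 ?_).resolve_left hw)
    linear_combination w 1 * e0 - w 0 * e1
  have hdet : B.1 0 0 * B.1 1 1 ≠ 0 := by
    have h : B.1.det ≠ 0 := B.det.ne_zero
    rw [Matrix.det_fin_two, b10] at h
    simpa using h
  refine ⟨P, Units.mk0 _ (left_ne_zero_of_mul hdet), Units.mk0 _ (right_ne_zero_of_mul hdet),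
    B.1 0 1, b00, ?_⟩
  have : upper2 (Units.mk0 _ (left_ne_zero_of_mul hdet)) (Units.mk0 _ (right_ne_zero_of_mul hdet))
      (B.1 0 1) = B := by
    ext i j
    fin_cases i <;> fin_cases j <;> simp [coe_upper2, b10]
  rw [this, hB]
  group

theorem upper2_pow_apply (a : kˣ) (b : k) (n : ℕ) :
    ((upper2 a a b) ^ (n + 1)).1 = !![(a : k) ^ (n + 1), (n + 1) * a ^ n * b; 0, a ^ (n + 1)] := by
  induction n with
  | zero => simp [coe_upper2]
  | succ n ih =>
    rw [pow_succ, Units.val_mul, ih, coe_upper2]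
    ext i j
    fin_cases i <;> fin_cases j <;> simp [Matrix.mul_apply, Fin.sum_univ_two] <;> ring

theorem conj_mk_eq_one_iff {P A : GL (Fin 2) k} : mk (P * A * P⁻¹) = 1 ↔ mk A = 1 := by
  rw [map_mul, map_mul, map_inv, mul_inv_eq_one, mul_eq_left]

/-- A power of a Jordan block has off-diagonal entry `(n + 1) a ^ n b`, which in characteristic zero
vanishes only if `b = 0`. -/
theorem eq_zero_of_isOfFinOrder_upper2 [CharZero k] {a : kˣ} {b : k}
    (h : IsOfFinOrder (mk (upper2 a a b))) : b = 0 := by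
  obtain ⟨n, hn, h⟩ := isOfFinOrder_iff_pow_eq_one.1 h
  obtain ⟨n, rfl⟩ := Nat.exists_eq_succ_of_ne_zero hn.ne'
  rw [← map_pow, mk_eq_one_iff] at h
  obtain ⟨c, hc⟩ := h
  have hc' : ((upper2 a a b) ^ (n + 1)).1 = (diag2 c c).1 := congrArg Units.val hc
  rw [upper2_pow_apply] at hc'
  have := congrFun (congrFun hc' 0) 1
  have h3 : (n : k) + 1 ≠ 0 := by exact_mod_cast n.succ_ne_zero
  simpa [diag2, h3] using this

theorem isOfFinOrder_mk_conj {P A : GL (Fin 2) k} (h : IsOfFinOrder (mk (P * A * P⁻¹))) :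
    IsOfFinOrder (mk A) := by
  obtain ⟨n, hn, h⟩ := isOfFinOrder_iff_pow_eq_one.1 h
  refine isOfFinOrder_iff_pow_eq_one.2 ⟨n, hn, ?_⟩
  rw [← map_pow, conj_pow, conj_mk_eq_one_iff] at h
  rw [← map_pow, h]

/-- If `a ^ 2` is the determinant, the other eigenvalue is also `a`, and finite order excludes a
Jordan block. This is the injectivity of the eigenvalue-ratio character. -/
theorem mk_eq_one_of_sq_eq_det [CharZero k] {A : GL (Fin 2) k} (hA : IsOfFinOrder (mk A))
    {v : Fin 2 → k} (hv : v ≠ 0) {a : k} (h : A.1.mulVec v = a • v) (hd : a ^ 2 = A.1.det) :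
    mk A = 1 := by
  obtain ⟨P, a', d, b, rfl, rfl⟩ := exists_conj_upper2 A hv h
  have had : a' = d := by
    have : (P * upper2 a' d b * P⁻¹).1.det = a' * d := by
      rw [Units.val_mul, Units.val_mul, Matrix.det_mul_right_comm, ← Units.val_mul, mul_inv_cancel]
      simp [coe_upper2]
    rw [this, pow_two] at hd
    exact Units.ext (mul_left_cancel₀ a'.ne_zero hd)
  subst had
  have hb := eq_zero_of_isOfFinOrder_upper2 (isOfFinOrder_mk_conj hA)
  rw [conj_mk_eq_one_iff, mk_eq_one_iff]
  refine ⟨a', ?_⟩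
  ext i j
  fin_cases i <;> fin_cases j <;> simp [coe_upper2, diag2, hb]

theorem exists_conj_diag2 [IsAlgClosed k] [CharZero k] {A : GL (Fin 2) k}
    (hA : IsOfFinOrder (mk A)) : ∃ (P : GL (Fin 2) k) (a d : kˣ), A = P * diag2 a d * P⁻¹ := by
  obtain ⟨a, ha⟩ := Module.End.exists_eigenvalue (Matrix.toLin' A.1)
  obtain ⟨v, hv, hv0⟩ := ha.exists_hasEigenvector
  have hv : A.1.mulVec v = a • v := by simpa using Module.End.mem_eigenspace_iff.1 hv
  obtain ⟨P, a', d, b, rfl, rfl⟩ := exists_conj_upper2 A hv0 hv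
  by_cases had : a' = d
  · subst had
    have hb := eq_zero_of_isOfFinOrder_upper2 (isOfFinOrder_mk_conj hA)
    refine ⟨P, a', a', ?_⟩
    have : upper2 a' a' b = diag2 a' a' := by
      ext i j
      fin_cases i <;> fin_cases j <;> simp [coe_upper2, diag2, hb]
    rw [this]
  · have had' : (d : k) - a' ≠ 0 := sub_ne_zero.2 fun h => had (Units.ext h.symm)
    -- The second column of `Q` is an eigenvector for `d`.
    let Q := upper2 1 1 (b / ((d : k) - a'))
    have hQ : upper2 a' d b * Q = Q * diag2 a' d := by
      ext i j
      fin_cases i <;> fin_cases j <;>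
        simp [coe_upper2, diag2, Q, Matrix.mul_apply, Fin.sum_univ_two]
      field_simp
      ring
    refine ⟨P * Q, a', d, ?_⟩
    rw [mul_assoc P Q, ← hQ]
    group

end PlaneGroups

/-! ### Finite subgroups of `PGL(2,k)` acting on the projective line -/

namespace PlaneGroups
open Matrix.ProjGenLinGroup MulAction

variable {k : Type*} [Field k]

theorem mk_smul_eq_iff {A : GL (Fin 2) k} {v : Fin 2 → k} (hv : v ≠ 0) :
    mk A • Projectivization.mk k v hv = Projectivization.mk k v hv ↔
      ∃ a : kˣ, A.1.mulVec v = (a : k) • v := by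
  rw [Projectivization.PGL.mk_smul_mk, Projectivization.mk_eq_mk_iff]
  exact exists_congr fun a => eq_comm

/-- The fixed points are the eigenlines, and a diagonalisable nonscalar matrix has exactly two. -/
theorem natCard_fixedBy [IsAlgClosed k] [CharZero k] {g : PGL(2, k)} (hg : IsOfFinOrder g)
    (hg1 : g ≠ 1) : Nat.card (fixedBy (ℙ k (Fin 2 → k)) g) = 2 := by
  obtain ⟨A, rfl⟩ := mk_surjective g
  obtain ⟨P, a, d, rfl⟩ := exists_conj_diag2 hg
  have had : (a : k) ≠ d := fun h => hg1 (by
    rw [conj_mk_eq_one_iff, Units.ext h, mk_diag2_self])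
  have hP : ∀ i, P.1.mulVec (Pi.single i 1) ≠ 0 := fun i h => by
    have := congrArg (P⁻¹.1.mulVec) h
    rw [Matrix.mulVec_mulVec, ← Units.val_mul, inv_mul_cancel] at this
    simpa using congrFun this i
  have key : ∀ (v : Fin 2 → k) (c : k), (P * diag2 a d * P⁻¹).1.mulVec v = c • v ↔
      (diag2 a d).1.mulVec (P⁻¹.1.mulVec v) = c • P⁻¹.1.mulVec v := by
    intro v c
    constructor
    · intro h
      have := congrArg (P⁻¹.1.mulVec) h
      rwa [Matrix.mulVec_mulVec, ← Units.val_mul, Matrix.mulVec_smul,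
        show P⁻¹ * (P * diag2 a d * P⁻¹) = diag2 a d * P⁻¹ by group, Units.val_mul,
        ← Matrix.mulVec_mulVec] at this
    · intro h
      have := congrArg (P.1.mulVec) h
      rwa [Matrix.mulVec_mulVec, Matrix.mulVec_mulVec, ← Units.val_mul, ← Units.val_mul,
        Matrix.mulVec_smul, Matrix.mulVec_mulVec, ← Units.val_mul, mul_inv_cancel, Units.val_one,
        Matrix.one_mulVec] at this
  have hset : fixedBy (ℙ k (Fin 2 → k)) (mk (P * diag2 a d * P⁻¹)) =
      {Projectivization.mk k _ (hP 0), Projectivization.mk k _ (hP 1)} := by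
    ext x
    induction x using Projectivization.ind with
    | h v hv =>
    have hvP : v = P.1.mulVec (P⁻¹.1.mulVec v) := by
      rw [Matrix.mulVec_mulVec, ← Units.val_mul, mul_inv_cancel, Units.val_one, Matrix.one_mulVec]
    rw [mem_fixedBy, mk_smul_eq_iff, Set.mem_insert_iff, Set.mem_singleton_iff,
      Projectivization.mk_eq_mk_iff', Projectivization.mk_eq_mk_iff']
    constructor
    · rintro ⟨c, hc⟩
      rw [key] at hc
      generalize P⁻¹.1.mulVec v = w at hc hvP
      have h0 : (a : k) * w 0 = c * w 0 := by
        simpa [diag2, Matrix.mulVec_diagonal] using congrFun hc 0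
      have h1 : (d : k) * w 1 = c * w 1 := by
        simpa [diag2, Matrix.mulVec_diagonal] using congrFun hc 1
      by_cases hw : w 1 = 0
      · left
        refine ⟨w 0, ?_⟩
        rw [hvP, ← Matrix.mulVec_smul]
        congr 1
        funext i
        fin_cases i <;> simp [hw]
      · right
        have hdc : (d : k) = c := mul_right_cancel₀ hw h1
        have hw0 : w 0 = 0 := by
          by_contra hw0
          exact had ((mul_right_cancel₀ hw0 h0).trans hdc.symm)
        refine ⟨w 1, ?_⟩
        rw [hvP, ← Matrix.mulVec_smul]
        congr 1
        funext i
        fin_cases i <;> simp [hw0]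
    · have hPP : ∀ w, P⁻¹.1.mulVec (P.1.mulVec w) = w := fun w => by
        rw [Matrix.mulVec_mulVec, ← Units.val_mul, inv_mul_cancel, Units.val_one,
          Matrix.one_mulVec]
      rintro (⟨c, rfl⟩ | ⟨c, rfl⟩)
      · refine ⟨a, ?_⟩
        rw [key, Matrix.mulVec_smul, hPP]
        funext i
        fin_cases i <;> simp [diag2, Matrix.mulVec_diagonal, mul_comm]
      · refine ⟨d, ?_⟩
        rw [key, Matrix.mulVec_smul, hPP]
        funext i
        fin_cases i <;> simp [diag2, Matrix.mulVec_diagonal, mul_comm]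
  rw [hset, Nat.card_coe_set_eq, Set.ncard_pair]
  rw [Ne, Projectivization.mk_eq_mk_iff']
  rintro ⟨c, hc⟩
  rw [← Matrix.mulVec_smul] at hc
  have := Matrix.mulVec_injective_of_isUnit P.isUnit hc
  simpa using congrFun this 0

/-- If `v` has eigenvalue `a`, then `a ^ 2 / det` is the ratio of the two eigenvalues. Rescaling the
matrix does not change it, so it is a character of the stabilizer; it is injective, and a finite
group embedded in the multiplicative monoid of a field is cyclic. -/
theorem isCyclic_stabilizer [CharZero k] (H : Subgroup PGL(2, k)) [Finite H]
    (x : ℙ k (Fin 2 → k)) : IsCyclic (stabilizer H x) := by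
  induction x using Projectivization.ind with
  | h v hv =>
  have hex : ∀ g : stabilizer H (Projectivization.mk k v hv), ∃ (A : GL (Fin 2) k) (a : k),
      mk A = (g : PGL(2, k)) ∧ A.1.mulVec v = a • v := by
    rintro ⟨⟨g, hgH⟩, hg⟩
    obtain ⟨A, rfl⟩ := mk_surjective g
    obtain ⟨a, ha⟩ := (mk_smul_eq_iff hv).1 hg
    exact ⟨A, a, rfl, ha⟩
  choose A a hA ha using hex
  have huniq : ∀ (B B' : GL (Fin 2) k) (b b' : k), mk B = mk B' → B.1.mulVec v = b • v →
      B'.1.mulVec v = b' • v → b ^ 2 * B.1.det⁻¹ = b' ^ 2 * B'.1.det⁻¹ := by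
    intro B B' b b' h hb hb'
    obtain ⟨u, rfl⟩ := mk_eq_mk_iff.1 h
    have hB : (B * Matrix.GeneralLinearGroup.scalar (Fin 2) u).1 = (u : k) • B.1 := by
      ext i j
      simp [Matrix.GeneralLinearGroup.scalar, mul_comm]
    rw [hB, Matrix.smul_mulVec, hb, smul_smul] at hb'
    rw [hB, Matrix.det_smul, Fintype.card_fin, ← smul_left_injective k hv hb']
    have := u.ne_zero
    have : B.1.det ≠ 0 := B.det.ne_zero
    field_simp
  let χ : stabilizer H (Projectivization.mk k v hv) →* k :=
    { toFun g := a g ^ 2 * (A g).1.det⁻¹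
      map_one' := by
        rw [huniq (A 1) 1 (a 1) 1 (by rw [hA, map_one]; rfl) (ha 1) (by simp)]
        simp
      map_mul' g h := by
        rw [huniq (A (g * h)) (A g * A h) (a (g * h)) (a g * a h)
          (by rw [map_mul, hA, hA, hA]; rfl) (ha _) ?_]
        · rw [Units.val_mul, Matrix.det_mul, mul_inv]
          ring
        · rw [Units.val_mul, ← Matrix.mulVec_mulVec, ha, Matrix.mulVec_smul, ha, smul_smul,
            mul_comm] }
  have hχ : ∀ g, χ g = 1 → g = 1 := by
    intro g h
    have hd : (A g).1.det ≠ 0 := (A g).det.ne_zero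
    have hfin : IsOfFinOrder (mk (A g)) := by
      rw [hA]
      exact MonoidHom.isOfFinOrder H.subtype (isOfFinOrder_of_finite g.1)
    have := mk_eq_one_of_sq_eq_det hfin hv (ha g) (by
      change a g ^ 2 * (A g).1.det⁻¹ = 1 at h
      rwa [mul_inv_eq_one₀ hd] at h)
    rw [hA] at this
    exact Subtype.ext (Subtype.ext this)
  exact isCyclic_of_injective_ringHom χ ((injective_iff_map_eq_one _).2 hχ)

theorem classification_PGL2 [IsAlgClosed k] [CharZero k] (H : Subgroup PGL(2, k)) [Finite H] :
    Nonempty (H ≃* alternatingGroup (Fin 5)) ∨ Nonempty (H ≃* Equiv.Perm (Fin 4)) ∨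
    Nonempty (H ≃* alternatingGroup (Fin 4)) ∨
    (∃ ν : ℕ, 2 ≤ ν ∧ Nonempty (H ≃* DihedralGroup ν)) ∨ IsCyclic H :=
  TwoPointAction.classification_of_fixedBy (X := ℙ k (Fin 2 → k))
    (fun g hg => natCard_fixedBy (MonoidHom.isOfFinOrder H.subtype (isOfFinOrder_of_finite g))
      fun h => hg (Subtype.ext h))
    (isCyclic_stabilizer H)

end PlaneGroups

/-! ### Scalars in a finite group of `2 × 2` matrices, and the cyclic case -/

namespace PlaneGroups
open Matrix.ProjGenLinGroup

variable {k : Type*} [Field k]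

theorem coe_diag2 (a b : kˣ) : (diag2 a b).1 = !![(a : k), 0; 0, (b : k)] := by
  ext i j
  fin_cases i <;> fin_cases j <;> simp [diag2]

theorem coe_swap2 (t : kˣ) : (swap2 t).1 = !![0, (t : k); (t : k), 0] := rfl

theorem diag2_mul (a b c d : kˣ) : diag2 a b * diag2 c d = diag2 (a * c) (b * d) := by
  apply Units.ext
  rw [Units.val_mul]
  simp [coe_diag2]

variable (k) in
/-- The homomorphism `(a,b) ↦ diag[a,b]`. -/
def diag2Hom : kˣ × kˣ →* GL (Fin 2) k where
  toFun p := diag2 p.1 p.2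
  map_one' := by
    apply Units.ext
    ext i j
    fin_cases i <;> fin_cases j <;> simp [diag2]
  map_mul' p q := (diag2_mul _ _ _ _).symm

theorem diag2_inj {a b c d : kˣ} : diag2 a b = diag2 c d ↔ a = c ∧ b = d := by
  refine ⟨fun h => ?_, fun h => by rw [h.1, h.2]⟩
  have h' := congrArg Units.val h
  rw [coe_diag2, coe_diag2] at h'
  exact ⟨Units.ext (by simpa using congrFun (congrFun h' 0) 0),
    Units.ext (by simpa using congrFun (congrFun h' 1) 1)⟩

theorem diag2_pow (a b : kˣ) (n : ℕ) : diag2 a b ^ n = diag2 (a ^ n) (b ^ n) :=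
  (map_pow (diag2Hom k) (a, b) n).symm

theorem diag2_zpow (a b : kˣ) (n : ℤ) : diag2 a b ^ n = diag2 (a ^ n) (b ^ n) :=
  (map_zpow (diag2Hom k) (a, b) n).symm

theorem diag2_inv (a b : kˣ) : (diag2 a b)⁻¹ = diag2 a⁻¹ b⁻¹ :=
  (map_inv (diag2Hom k) (a, b)).symm

theorem swap2_mul_diag2 (a b t : kˣ) : swap2 t * diag2 a b = diag2 b a * swap2 t := by
  apply Units.ext
  rw [Units.val_mul, Units.val_mul]
  simp [coe_diag2, coe_swap2, mul_comm]

theorem swap2_mul_swap2 (s t : kˣ) : swap2 s * swap2 t = diag2 (s * t) (s * t) := by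
  apply Units.ext
  rw [Units.val_mul]
  simp [coe_diag2, coe_swap2]

theorem mk_diag2_eq_one_iff {a b : kˣ} : mk (diag2 a b) = 1 ↔ a = b := by
  rw [mk_eq_one_iff]
  simp only [diag2_inj]
  exact ⟨fun ⟨_, h⟩ => h.1.trans h.2.symm, fun h => ⟨b, h, rfl⟩⟩

theorem orderOf_mk_diag2 (α ε : kˣ) : orderOf (mk (diag2 (α * ε) α)) = orderOf ε := by
  refine orderOf_eq_orderOf_iff.2 fun n => ?_
  rw [← map_pow, diag2_pow, mk_diag2_eq_one_iff, mul_pow, mul_eq_left]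

theorem diag2_comm (u : kˣ) (A : GL (Fin 2) k) : diag2 u u * A = A * diag2 u u := by
  apply Units.ext
  rw [Units.val_mul, Units.val_mul]
  ext i j
  fin_cases i <;> fin_cases j <;> simp [coe_diag2, Matrix.mul_apply, Fin.sum_univ_two, mul_comm]

/-- `η` generates the group of scalars contained in `K`. -/
def ScalarsGenBy (K : Subgroup (GL (Fin 2) k)) (η : kˣ) : Prop :=
  ∀ u, diag2 u u ∈ K ↔ u ∈ Subgroup.zpowers η

/-- The conjugate `P K P⁻¹`. -/
def conjGL (P : GL (Fin 2) k) (K : Subgroup (GL (Fin 2) k)) : Subgroup (GL (Fin 2) k) :=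
  K.map (MulAut.conj P).toMonoidHom

theorem mem_conjGL {P A : GL (Fin 2) k} {K : Subgroup (GL (Fin 2) k)} :
    A ∈ conjGL P K ↔ P⁻¹ * A * P ∈ K := by
  constructor
  · rintro ⟨B, hB, rfl⟩
    have : P⁻¹ * (P * B * P⁻¹) * P = B := by group
    exact this.symm ▸ hB
  · intro h
    refine ⟨_, h, ?_⟩
    change P * (P⁻¹ * A * P) * P⁻¹ = A
    group

theorem conjGL_conjGL (P Q : GL (Fin 2) k) (K : Subgroup (GL (Fin 2) k)) :
    conjGL P (conjGL Q K) = conjGL (P * Q) K := by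
  ext A
  rw [mem_conjGL, mem_conjGL, mem_conjGL]
  simp only [mul_inv_rev, mul_assoc]

namespace ScalarsGenBy

variable {K : Subgroup (GL (Fin 2) k)} {η : kˣ}

theorem conj (h : ScalarsGenBy K η) (P : GL (Fin 2) k) : ScalarsGenBy (conjGL P K) η := by
  intro u
  rw [mem_conjGL, mul_assoc, diag2_comm, inv_mul_cancel_left, h]

theorem of_le (h : ScalarsGenBy K η) {L : Subgroup (GL (Fin 2) k)} (hL : L ≤ K)
    (hη : diag2 η η ∈ L) : ScalarsGenBy L η := by
  intro u
  refine ⟨fun hu => (h u).1 (hL hu), ?_⟩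
  rintro ⟨n, rfl⟩
  rw [← diag2_zpow]
  exact L.zpow_mem hη n

theorem self_mem (h : ScalarsGenBy K η) : diag2 η η ∈ K :=
  (h η).2 (Subgroup.mem_zpowers η)

theorem inf_ker (h : ScalarsGenBy K η) : K ⊓ mk.ker = Subgroup.zpowers (diag2 η η) := by
  ext A
  rw [Subgroup.mem_inf, MonoidHom.mem_ker, mk_eq_one_iff, Subgroup.mem_zpowers_iff]
  constructor
  · rintro ⟨hA, u, rfl⟩
    obtain ⟨n, rfl⟩ := (h u).1 hA
    exact ⟨n, diag2_zpow _ _ _⟩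
  · rintro ⟨n, rfl⟩
    exact ⟨K.zpow_mem h.self_mem n, _, diag2_zpow _ _ _⟩

theorem card_eq (h : ScalarsGenBy K η) : orderOf η * Nat.card (K.map mk) = Nat.card K := by
  have h1 : Nat.card (mk.domRestrict K).ker = orderOf η := by
    have h2 : orderOf (diag2 η η) = orderOf η := by
      refine orderOf_eq_orderOf_iff.2 fun n => ?_
      rw [diag2_pow, ← map_one (diag2Hom k)]
      exact diag2_inj.trans ⟨fun h => h.1, fun h => ⟨h, h⟩⟩
    rw [← h2, ← Nat.card_zpowers, ← h.inf_ker, MonoidHom.ker_domRestrict, inf_comm,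
      ← Subgroup.subgroupOf_map_subtype]
    exact Nat.card_congr
      (Subgroup.equivMapOfInjective _ _ K.subtype_injective).toEquiv
  rw [← (mk.domRestrict K).ker.card_mul_index, h1, Subgroup.index_ker, MonoidHom.domRestrict_range]

end ScalarsGenBy

/-- The scalars in `K` form a finite subgroup of `kˣ`, hence a cyclic one. -/
theorem exists_scalarsGenBy (K : Subgroup (GL (Fin 2) k)) [Finite K] : ∃ η, ScalarsGenBy K η := by
  let f : kˣ →* GL (Fin 2) k := (diag2Hom k).comp (MonoidHom.prod (.id _) (.id _))
  have hf : Function.Injective f := fun a b h => (diag2_inj.1 h).1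
  have : Finite (K.comap f) := Finite.of_injective (fun x => (⟨f x, x.2⟩ : K)) fun x y h =>
    Subtype.ext (hf (congrArg Subtype.val h))
  obtain ⟨η, hη⟩ := (Subgroup.isCyclic_iff_exists_zpowers_eq_top _).1
    (inferInstance : IsCyclic (K.comap f))
  exact ⟨η, fun u => by rw [hη]; rfl⟩

section Core

variable {K : Subgroup (GL (Fin 2) k)} {η α ε : kˣ}

theorem pow_mem_of_scalarsGenBy (h : ScalarsGenBy K η) (hD : diag2 (α * ε) α ∈ K) :
    α ^ orderOf ε ∈ Subgroup.zpowers η := by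
  rw [← h]
  have := K.pow_mem hD (orderOf ε)
  rwa [diag2_pow, mul_pow, pow_orderOf_eq_one, mul_one] at this

/-- `A` differs from a power of the diagonal matrix by an element of `K` with trivial image, that
is, by a power of `diag2 η η`. -/
theorem mem_closure_of_mk_mem_zpowers (h : ScalarsGenBy K η) (hD : diag2 (α * ε) α ∈ K)
    {A : GL (Fin 2) k} (hA : A ∈ K) (hmk : mk A ∈ Subgroup.zpowers (mk (diag2 (α * ε) α))) :
    A ∈ Subgroup.closure {diag2 (α * ε) α, diag2 η η} := by
  obtain ⟨n, hn⟩ := hmk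
  have h1 : A * (diag2 (α * ε) α ^ n)⁻¹ ∈ K ⊓ mk.ker := by
    refine ⟨K.mul_mem hA (K.inv_mem (K.zpow_mem hD n)), ?_⟩
    change mk _ = 1
    rw [map_mul, map_inv, map_zpow]
    exact mul_inv_eq_one.2 hn.symm
  rw [h.inf_ker] at h1
  obtain ⟨m, hm⟩ := h1
  have : A = diag2 η η ^ m * diag2 (α * ε) α ^ n := by
    rw [eq_mul_inv_iff_mul_eq.1 hm]
  rw [this]
  exact mul_mem (zpow_mem (Subgroup.subset_closure (by simp)) m)
    (zpow_mem (Subgroup.subset_closure (by simp)) n)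

theorem closure_le_of_scalarsGenBy (h : ScalarsGenBy K η) (hD : diag2 (α * ε) α ∈ K) :
    Subgroup.closure {diag2 (α * ε) α, diag2 η η} ≤ K := by
  rw [Subgroup.closure_le]
  rintro x (rfl | rfl)
  · exact hD
  · exact h.self_mem

theorem map_mk_closure (α ε η : kˣ) :
    (Subgroup.closure {diag2 (α * ε) α, diag2 η η}).map mk =
      Subgroup.zpowers (mk (diag2 (α * ε) α)) := by
  rw [MonoidHom.map_closure, Set.image_pair, mk_diag2_self, Set.pair_comm,
    Subgroup.closure_insert_one, Subgroup.zpowers_eq_closure]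

theorem card_closure (h : ScalarsGenBy K η) (hD : diag2 (α * ε) α ∈ K) :
    Nat.card (Subgroup.closure {diag2 (α * ε) α, diag2 η η}) = orderOf ε * orderOf η := by
  have h' := h.of_le (closure_le_of_scalarsGenBy h hD) (Subgroup.subset_closure (by simp))
  rw [← h'.card_eq, map_mk_closure, Nat.card_zpowers, orderOf_mk_diag2, mul_comm]

end Core

theorem exists_isDiag_conj [IsAlgClosed k] [CharZero k] {K : Subgroup (GL (Fin 2) k)} [Finite K]
    {A : GL (Fin 2) k} (hA : A ∈ K) : ∃ (P : GL (Fin 2) k) (α ε : kˣ),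
      P * A * P⁻¹ = diag2 (α * ε) α := by
  have hfin : IsOfFinOrder (mk A) := mk.isOfFinOrder
    (MonoidHom.isOfFinOrder K.subtype (isOfFinOrder_of_finite (⟨A, hA⟩ : K)))
  obtain ⟨P, a, d, rfl⟩ := exists_conj_diag2 hfin
  exact ⟨P⁻¹, d, d⁻¹ * a, by rw [mul_inv_cancel_left]; group⟩

/-- One `P` serves every `ε`: it diagonalises a lift of a generator, and changing `ε` amounts to
replacing this lift by a power of it. -/
theorem exists_cyclic_form [IsAlgClosed k] [CharZero k] (K : Subgroup (GL (Fin 2) k)) [Finite K]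
    {η : kˣ} (h : ScalarsGenBy K η) (hc : IsCyclic (K.map mk)) : ∃ P : GL (Fin 2) k,
      ∀ ε : kˣ, orderOf ε = Nat.card (K.map mk) → ∃ α : kˣ,
        α ^ orderOf ε ∈ Subgroup.zpowers η ∧
        conjGL P K = Subgroup.closure {diag2 (α * ε) α, diag2 η η} := by
  obtain ⟨g, hg⟩ := (Subgroup.isCyclic_iff_exists_zpowers_eq_top _).1 hc
  obtain ⟨A, hA, rfl⟩ : g ∈ K.map mk := hg ▸ Subgroup.mem_zpowers g
  obtain ⟨P, α₀, ε₀, hP⟩ := exists_isDiag_conj hA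
  refine ⟨P, fun ε hε => ?_⟩
  have hmk : mk A = (mk P)⁻¹ * mk (diag2 (α₀ * ε₀) α₀) * mk P := by
    rw [← hP]
    simp only [map_mul, map_inv]
    group
  have hord : orderOf ε₀ = orderOf ε := by
    rw [hε, ← hg, Nat.card_zpowers, ← orderOf_mk_diag2 α₀ ε₀, ← hP]
    simp only [map_mul, map_inv]
    exact (MulAut.conj (mk P)).orderOf_eq (mk A)
  have : Finite (K.map mk) := Set.Finite.image mk (Set.toFinite (K : Set (GL (Fin 2) k)))
  have hpos : 0 < orderOf ε := hε ▸ Nat.card_pos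
  -- Both have order `ν`, and the roots of unity of order dividing `ν` are the powers of any
  -- primitive one.
  obtain ⟨j, hj⟩ : ε ∈ Subgroup.zpowers ε₀ := by
    have : NeZero (orderOf ε) := ⟨hpos.ne'⟩
    rw [(hord ▸ IsPrimitiveRoot.orderOf ε₀ : IsPrimitiveRoot ε₀ (orderOf ε)).zpowers_eq,
      mem_rootsOfUnity]
    exact pow_orderOf_eq_one ε
  have hD₀ : diag2 (α₀ * ε₀) α₀ ∈ conjGL P K := ⟨A, hA, hP⟩
  have hD : diag2 (α₀ ^ j * ε) (α₀ ^ j) ∈ conjGL P K := by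
    have := (conjGL P K).zpow_mem hD₀ j
    rwa [diag2_zpow, mul_zpow, show ε₀ ^ j = ε from hj] at this
  refine ⟨α₀ ^ j, pow_mem_of_scalarsGenBy (h.conj P) hD, le_antisymm ?_
    (closure_le_of_scalarsGenBy (h.conj P) hD)⟩
  intro B hB
  refine mem_closure_of_mk_mem_zpowers (h.conj P) hD hB ?_
  have h1 : Subgroup.zpowers (mk (diag2 (α₀ ^ j * ε) (α₀ ^ j))) =
      Subgroup.zpowers (mk (diag2 (α₀ * ε₀) α₀)) := by
    have hfin : Finite (Subgroup.zpowers (mk (diag2 (α₀ * ε₀) α₀))) := by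
      apply Nat.finite_of_card_ne_zero
      rw [Nat.card_zpowers, orderOf_mk_diag2, hord]
      exact hpos.ne'
    apply Subgroup.eq_of_le_of_card_ge
    · rw [Subgroup.zpowers_le]
      refine ⟨j, ?_⟩
      change mk _ ^ j = _
      rw [← map_zpow, diag2_zpow, mul_zpow, show ε₀ ^ j = ε from hj]
    · rw [Nat.card_zpowers, Nat.card_zpowers, orderOf_mk_diag2, orderOf_mk_diag2, hord]
  rw [h1]
  obtain ⟨C, hC, rfl⟩ := hB
  obtain ⟨n, hn⟩ : mk C ∈ Subgroup.zpowers (mk A) := hg ▸ Subgroup.mem_map_of_mem mk hC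
  refine ⟨n, ?_⟩
  change mk _ ^ n = mk (P * C * P⁻¹)
  rw [← hP]
  simp only [map_mul, map_inv, conj_zpow, ← hn]

end PlaneGroups

/-! ### The dihedral case -/

namespace PlaneGroups
open Matrix.ProjGenLinGroup

variable {k : Type*} [Field k]

theorem exists_diag2_of_mem_closure {α ε η : kˣ} {A : GL (Fin 2) k}
    (hA : A ∈ Subgroup.closure {diag2 (α * ε) α, diag2 η η}) : ∃ a b, A = diag2 a b := by
  have : Subgroup.closure {diag2 (α * ε) α, diag2 η η} ≤ (diag2Hom k).range := by
    rw [Subgroup.closure_le]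
    rintro x (rfl | rfl)
    · exact ⟨(_, _), rfl⟩
    · exact ⟨(_, _), rfl⟩
  obtain ⟨⟨a, b⟩, rfl⟩ := this hA
  exact ⟨a, b, rfl⟩

theorem diag2_ne_diag2_mul_swap2 (a b c d t : kˣ) : diag2 a b ≠ diag2 c d * swap2 t := by
  intro h
  have h' := congrArg Units.val h
  rw [Units.val_mul, coe_diag2, coe_diag2, coe_swap2] at h'
  simpa [Matrix.mul_apply, Fin.sum_univ_two] using congrFun (congrFun h' 0) 0

/-- The normal form of a group of `2 × 2` matrices whose image in `PGL(2,k)` is dihedral. -/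
structure DihedralForm (K : Subgroup (GL (Fin 2) k)) (ν : ℕ) (η α ε θ : kˣ) : Prop where
  eq_closure : K = Subgroup.closure {diag2 (α * ε) α, diag2 η η, swap2 θ}
  theta : θ = 1 ∨ θ ^ 2 = η
  order : orderOf ε = ν
  pow_mem : α ^ ν ∈ Subgroup.zpowers η
  sq_mem : α ^ 2 * ε ∈ Subgroup.zpowers η
  trivial : orderOf η = 1 → Odd ν ∧ α = ε ^ ((ν - 1) / 2) ∧ θ = 1
  union : (K : Set (GL (Fin 2) k)) =
    (Subgroup.closure {diag2 (α * ε) α, diag2 η η} : Set (GL (Fin 2) k)) ∪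
      (fun x => x * swap2 θ) '' Subgroup.closure {diag2 (α * ε) α, diag2 η η}
  disj : Disjoint (Subgroup.closure {diag2 (α * ε) α, diag2 η η} : Set (GL (Fin 2) k))
    ((fun x => x * swap2 θ) '' Subgroup.closure {diag2 (α * ε) α, diag2 η η})
  card : Nat.card (Subgroup.closure {diag2 (α * ε) α, diag2 η η}) = ν * orderOf η

/-- Here `ε = α⁻²`. For `ν = 2m` this gives `ε ^ m = α ^ (-ν) = 1`, against the order of `ε`; for `ν
= 2m + 1` it gives `ε ^ m = α ^ (-2m) = α`. -/
theorem eq_pow_half_of_sq_mul_eq_one {ν : ℕ} {α ε : kˣ} (hν : 2 ≤ ν) (hε : orderOf ε = ν)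
    (h1 : α ^ ν = 1) (h2 : α ^ 2 * ε = 1) : Odd ν ∧ α = ε ^ ((ν - 1) / 2) := by
  have hε' : ε = (α ^ 2)⁻¹ := eq_inv_of_mul_eq_one_right h2
  have hodd : Odd ν := by
    rw [← Nat.not_even_iff_odd]
    rintro ⟨m, hm⟩
    have h3 : ε ^ m = 1 := by
      rw [hε', inv_pow, ← pow_mul, show 2 * m = ν by omega, h1, inv_one]
    have := Nat.le_of_dvd (by omega) (orderOf_dvd_of_pow_eq_one h3)
    omega
  refine ⟨hodd, ?_⟩
  obtain ⟨m, rfl⟩ := hodd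
  rw [hε', show (2 * m + 1 - 1) / 2 = m by omega, inv_pow, ← pow_mul, eq_inv_iff_mul_eq_one,
    ← pow_succ', h1]

/-- The clause `η ≠ 1` in `hθ` is what yields `θ = 1` when the scalars are trivial. -/
theorem dihedralForm_of_mem {K : Subgroup (GL (Fin 2) k)} {η α ε θ : kˣ}
    (h : ScalarsGenBy K η) (hν : 2 ≤ orderOf ε) (hD : diag2 (α * ε) α ∈ K) (hS : swap2 θ ∈ K)
    (hθ : θ = 1 ∨ η ≠ 1 ∧ θ ^ 2 = η)
    (hK : ∀ A ∈ K, mk A ∈ Subgroup.zpowers (mk (diag2 (α * ε) α)) ∨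
      mk (A * (swap2 θ)⁻¹) ∈ Subgroup.zpowers (mk (diag2 (α * ε) α))) :
    DihedralForm K (orderOf ε) η α ε θ := by
  have hunion : (K : Set (GL (Fin 2) k)) =
      (Subgroup.closure {diag2 (α * ε) α, diag2 η η} : Set (GL (Fin 2) k)) ∪
        (fun x => x * swap2 θ) '' Subgroup.closure {diag2 (α * ε) α, diag2 η η} := by
    have hle := closure_le_of_scalarsGenBy h hD
    ext A
    constructor
    · intro hA
      rcases hK A hA with hA' | hA'
      · exact .inl (mem_closure_of_mk_mem_zpowers h hD hA hA')
      · exact .inr ⟨_, mem_closure_of_mk_mem_zpowers h hD (K.mul_mem hA (K.inv_mem hS)) hA',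
          inv_mul_cancel_right _ _⟩
    · rintro (hA | ⟨B, hB, rfl⟩)
      · exact hle hA
      · exact K.mul_mem (hle hB) hS
  have hsq : α ^ 2 * ε ∈ Subgroup.zpowers η := by
    rw [← h]
    -- Conjugation by the swap exchanges the diagonal entries, so this product is the scalar `α ^ 2
    -- * ε`.
    have h1 : swap2 θ * diag2 (α * ε) α * (swap2 θ)⁻¹ * diag2 (α * ε) α ∈ K :=
      K.mul_mem (K.mul_mem (K.mul_mem hS hD) (K.inv_mem hS)) hD
    rw [swap2_mul_diag2, mul_inv_cancel_right, diag2_mul] at h1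
    rwa [show α * (α * ε) = α ^ 2 * ε by rw [pow_two, mul_assoc],
      show α * ε * α = α ^ 2 * ε by rw [pow_two, mul_right_comm]] at h1
  have hpow := pow_mem_of_scalarsGenBy h hD
  refine ⟨le_antisymm ?_ ?_, hθ.imp_right And.right, rfl, hpow, hsq, ?_, hunion, ?_, card_closure h hD⟩
  · intro A hA
    rw [← SetLike.mem_coe, hunion] at hA
    have hle : Subgroup.closure {diag2 (α * ε) α, diag2 η η} ≤
        Subgroup.closure {diag2 (α * ε) α, diag2 η η, swap2 θ} :=
      Subgroup.closure_mono (by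
        rintro x (rfl | rfl) <;> simp)
    rcases hA with hA | ⟨B, hB, rfl⟩
    · exact hle hA
    · exact mul_mem (hle hB) (Subgroup.subset_closure (by simp))
  · rw [Subgroup.closure_le]
    rintro x (rfl | rfl | rfl)
    · exact hD
    · exact h.self_mem
    · exact hS
  · intro hη
    rw [orderOf_eq_one_iff] at hη
    subst hη
    rw [Subgroup.zpowers_one_eq_bot, Subgroup.mem_bot] at hpow hsq
    obtain ⟨h1, h2⟩ := eq_pow_half_of_sq_mul_eq_one hν rfl hpow hsq
    exact ⟨h1, h2, hθ.resolve_right fun h => h.1 rfl⟩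
  · rw [Set.disjoint_left]
    rintro A hA ⟨B, hB, rfl⟩
    obtain ⟨a, b, h1⟩ := exists_diag2_of_mem_closure hA
    obtain ⟨c, d, rfl⟩ := exists_diag2_of_mem_closure hB
    exact diag2_ne_diag2_mul_swap2 _ _ _ _ _ h1.symm

/-- The elements `a` and `s` generate `H` as a dihedral group, with rotation `a` and
reflection `s`. -/
structure DihedralPair {G : Type*} [Group G] (H : Subgroup G) (a s : G) : Prop where
  notMem : s ∉ Subgroup.zpowers a
  sq : s * s = 1
  rel : a * s * a = s
  cover : ∀ g ∈ H, g ∈ Subgroup.zpowers a ∨ g * s⁻¹ ∈ Subgroup.zpowers a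

theorem DihedralPair.map {G G' : Type*} [Group G] [Group G'] {H : Subgroup G} {a s : G}
    (h : DihedralPair H a s) (φ : G →* G') (hφ : Function.Injective φ) :
    DihedralPair (H.map φ) (φ a) (φ s) := by
  have key : ∀ x, φ x ∈ Subgroup.zpowers (φ a) ↔ x ∈ Subgroup.zpowers a := fun x => by
    rw [← MonoidHom.map_zpowers, Subgroup.mem_map_iff_mem hφ]
  refine ⟨fun hs => h.notMem ((key s).1 hs), ?_, ?_, ?_⟩
  · rw [← map_mul, h.sq, map_one]
  · rw [← map_mul, ← map_mul, h.rel]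
  · rintro _ ⟨g, hg, rfl⟩
    rw [← map_inv, ← map_mul, key, key]
    exact h.cover g hg

theorem dihedralPair_r_sr (ν : ℕ) :
    DihedralPair (⊤ : Subgroup (DihedralGroup ν)) (.r 1) (.sr 0) := by
  have hr : ∀ i : ZMod ν, DihedralGroup.r i ∈ Subgroup.zpowers (DihedralGroup.r (1 : ZMod ν)) := by
    intro i
    obtain ⟨j, rfl⟩ := ZMod.intCast_surjective i
    exact ⟨j, DihedralGroup.r_one_zpow j⟩
  refine ⟨?_, DihedralGroup.sr_mul_self 0, ?_, ?_⟩
  · rintro ⟨j, hj⟩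
    simp at hj
  · simp
  · rintro (i | i) -
    · exact .inl (hr i)
    · right
      simpa using hr _

theorem diag2_mul_swap2 (a b : kˣ) : diag2 a a * swap2 b = swap2 (a * b) := by
  apply Units.ext
  rw [Units.val_mul]
  simp [coe_diag2, coe_swap2]

/-- Lifted to matrices, the relation reads `D S D = u S`: the diagonal entries of `S` are multiplied
by `d ^ 2` and `α ^ 2`, the others by `d * α`. Since `d ≠ α`, a nonzero off-diagonal entry forces
both diagonal entries to vanish. -/
theorem exists_eq_diag2_mul_swap2 [CharZero k] {α ε : kˣ} {S : GL (Fin 2) k} (hε : ε ≠ 1)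
    (hs : mk S ∉ Subgroup.zpowers (mk (diag2 (α * ε) α))) (hsq : mk S * mk S = 1)
    (hrel : mk (diag2 (α * ε) α) * mk S * mk (diag2 (α * ε) α) = mk S) :
    ∃ q t, S = diag2 q t * swap2 1 := by
  obtain ⟨d, hd⟩ : ∃ d, d = α * ε := ⟨_, rfl⟩
  have hne : (d : k) ≠ α := fun h => hε (by
    have := Units.ext h
    rwa [hd, mul_eq_left] at this)
  rw [← hd] at hs hrel
  obtain ⟨p, hp⟩ : ∃ p, p = S.1 0 0 := ⟨_, rfl⟩
  obtain ⟨q, hq⟩ : ∃ q, q = S.1 0 1 := ⟨_, rfl⟩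
  obtain ⟨t, ht⟩ : ∃ t, t = S.1 1 0 := ⟨_, rfl⟩
  obtain ⟨w, hw⟩ : ∃ w, w = S.1 1 1 := ⟨_, rfl⟩
  have hS : S.1 = !![p, q; t, w] := by
    ext i j
    fin_cases i <;> fin_cases j <;> simp [hp, hq, ht, hw]
  have hdet : p * w - q * t ≠ 0 := by
    have : S.1.det ≠ 0 := S.det.ne_zero
    rwa [hS, Matrix.det_fin_two_of] at this
  rw [← map_mul, ← map_mul] at hrel
  obtain ⟨u, hu⟩ := mk_eq_mk_iff.1 hrel.symm
  rw [← diag2_self] at hu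
  have hu' := congrArg Units.val hu
  simp only [Units.val_mul, coe_diag2, hS, Matrix.mul_fin_two] at hu'
  have u00 : p * u = d * p * d := by simpa using congrFun (congrFun hu' 0) 0
  have u01 : q * u = d * q * α := by simpa using congrFun (congrFun hu' 0) 1
  have u10 : t * u = α * t * d := by simpa using congrFun (congrFun hu' 1) 0
  have u11 : w * u = α * w * α := by simpa using congrFun (congrFun hu' 1) 1
  -- A diagonal `S` with scalar square has `p = w` or `p = -w`. Then its class is trivial or,
  -- because `d = -α`, equal to that of the rotation; both contradict `hs`.
  by_cases hqt : q = 0 ∧ t = 0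
  · exfalso
    obtain ⟨rfl, rfl⟩ := hqt
    rw [zero_mul, sub_zero] at hdet
    have hp0 := left_ne_zero_of_mul hdet
    have hw0 := right_ne_zero_of_mul hdet
    have hSd : S = diag2 (Units.mk0 p hp0) (Units.mk0 w hw0) := by
      apply Units.ext
      rw [hS, coe_diag2]
      rfl
    have hpw : p ^ 2 = w ^ 2 := by
      rw [← map_mul, hSd, diag2_mul, mk_diag2_eq_one_iff] at hsq
      simpa [pow_two] using congrArg Units.val hsq
    rcases sq_eq_sq_iff_eq_or_eq_neg.1 hpw with h | h
    · refine hs ?_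
      have : mk S = 1 := by rw [hSd, mk_diag2_eq_one_iff]; exact Units.ext h
      rw [this]
      exact one_mem _
    · refine hs ⟨1, ?_⟩
      have e1 : (u : k) = d ^ 2 := by
        apply mul_left_cancel₀ hp0
        linear_combination u00
      have e2 : (u : k) = α ^ 2 := by
        apply mul_left_cancel₀ hw0
        linear_combination u11
      have e3 : (d : k) = -α :=
        (sq_eq_sq_iff_eq_or_eq_neg.1 (e1.symm.trans e2)).resolve_left hne
      change mk _ ^ (1 : ℤ) = mk S
      rw [zpow_one, ← mul_inv_eq_one, ← map_inv, ← map_mul, hSd, diag2_inv, diag2_mul,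
        mk_diag2_eq_one_iff]
      apply Units.ext
      simp [h, e3]
  · have hua : (u : k) = d * α := by
      by_cases hq0 : q = 0
      · have ht0 : t ≠ 0 := fun h => hqt ⟨hq0, h⟩
        apply mul_left_cancel₀ ht0
        linear_combination u10
      · apply mul_left_cancel₀ hq0
        linear_combination u01
    have hp0 : p = 0 := by
      have : p * (d * (d - α)) = 0 := by
        rw [hua] at u00
        linear_combination -u00
      exact (mul_eq_zero.1 this).resolve_right (mul_ne_zero d.ne_zero (sub_ne_zero.2 hne))
    have hw0 : w = 0 := by
      have : w * (α * (d - α)) = 0 := by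
        rw [hua] at u11
        linear_combination u11
      exact (mul_eq_zero.1 this).resolve_right (mul_ne_zero α.ne_zero (sub_ne_zero.2 hne))
    rw [hp0, zero_mul, zero_sub, neg_ne_zero] at hdet
    refine ⟨Units.mk0 q (left_ne_zero_of_mul hdet), Units.mk0 t (right_ne_zero_of_mul hdet), ?_⟩
    apply Units.ext
    rw [hS, Units.val_mul, coe_diag2, coe_swap2, hp0, hw0]
    simp

/-- The square of the reflection is the scalar `q * t`, a power of `η`. Multiplying by the scalar `c
= η ^ (-i)` brings the product of its two entries to 1 or `η`, by the parity of the exponent.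
Conjugation by `diag2 x 1` multiplies one entry by `x` and the other by `x⁻¹`, which makes them
equal. -/
theorem exists_rescale [IsAlgClosed k] [CharZero k] {K : Subgroup (GL (Fin 2) k)} {η q t : kˣ}
    (h : ScalarsGenBy K η) (hS : diag2 q t * swap2 1 ∈ K) :
    ∃ x θ : kˣ, (θ = 1 ∨ η ≠ 1 ∧ θ ^ 2 = η) ∧ swap2 θ ∈ conjGL (diag2 x 1) K ∧
      mk (swap2 θ) = mk (diag2 x 1 * (diag2 q t * swap2 1) * (diag2 x 1)⁻¹) := by
  obtain ⟨j, hj⟩ : q * t ∈ Subgroup.zpowers η := by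
    rw [← h]
    have := K.mul_mem hS hS
    rwa [mul_assoc, ← mul_assoc (swap2 1), swap2_mul_diag2, mul_assoc, swap2_mul_swap2, one_mul,
      diag2_mul, mul_one, mul_one, diag2_mul, mul_comm t] at this
  change η ^ j = q * t at hj
  obtain ⟨i, hi⟩ : ∃ i : ℤ, q * t = (η ^ i) ^ 2 ∨ η ≠ 1 ∧ q * t = (η ^ i) ^ 2 * η := by
    by_cases hη : η = 1
    · exact ⟨0, .inl (by rw [← hj, hη]; simp)⟩
    · rcases Int.even_or_odd' j with ⟨i, rfl | rfl⟩
      · exact ⟨i, .inl (by rw [← hj, zpow_mul', zpow_ofNat])⟩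
      · exact ⟨i, .inr ⟨hη, by rw [← hj, zpow_add, zpow_mul', zpow_ofNat, zpow_one]⟩⟩
  let c := (η ^ i)⁻¹
  have key : ∀ x θ : kˣ, x * (c * q) = θ → c * t * x⁻¹ = θ → (θ = 1 ∨ η ≠ 1 ∧ θ ^ 2 = η) →
      ∃ x θ : kˣ, (θ = 1 ∨ η ≠ 1 ∧ θ ^ 2 = η) ∧ swap2 θ ∈ conjGL (diag2 x 1) K ∧
        mk (swap2 θ) = mk (diag2 x 1 * (diag2 q t * swap2 1) * (diag2 x 1)⁻¹) := by
    intro x θ h1 h2 hθ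
    have hc : diag2 c c ∈ K := (h c).2 (inv_mem (Subgroup.zpow_mem_zpowers η i))
    have e : swap2 θ = diag2 x 1 * (diag2 c c * (diag2 q t * swap2 1)) * (diag2 x 1)⁻¹ := by
      rw [diag2_inv, ← mul_assoc, ← mul_assoc, mul_assoc _ (swap2 1), swap2_mul_diag2, ← mul_assoc,
        diag2_mul, diag2_mul, diag2_mul, inv_one, mul_one, one_mul, h2, mul_assoc x, h1,
        diag2_mul_swap2, mul_one]
    refine ⟨x, θ, hθ, ⟨_, K.mul_mem hc hS, e.symm⟩, ?_⟩
    rw [e]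
    simp only [map_mul, mk_diag2_self, one_mul]
  rcases hi with hi | ⟨hη, hi⟩
  · have : c * q * (c * t) = 1 := by
      rw [mul_mul_mul_comm, hi]
      simp only [c]
      group
    refine key (c * t) 1 ?_ (mul_inv_cancel _) (.inl rfl)
    rw [mul_comm, this]
  · have h1 : c * q * (c * t) = η := by
      rw [mul_mul_mul_comm, hi]
      simp only [c]
      group
    -- Equality of `x * (c * q)` and `c * t * x⁻¹` requires a square root of the quotient of the
    -- entries.
    obtain ⟨z, hz⟩ := IsAlgClosed.exists_pow_nat_eq ((c * t / (c * q) : kˣ) : k) two_pos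
    have hz0 : z ≠ 0 := by
      rintro rfl
      exact (c * t / (c * q)).ne_zero (by rw [← hz]; simp)
    obtain ⟨x, rfl⟩ : ∃ x : kˣ, (x : k) = z := ⟨Units.mk0 z hz0, rfl⟩
    have hx : x ^ 2 * (c * q) = c * t := by
      rw [← eq_div_iff_mul_eq']
      exact Units.ext (by simpa using hz)
    refine key x _ rfl ?_ (.inr ⟨hη, ?_⟩)
    · rw [← hx, pow_two, mul_inv_eq_iff_eq_mul]
      rw [mul_assoc, mul_comm]
    · rw [← h1, ← hx, mul_pow, pow_two (c * q)]
      rw [mul_left_comm]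

theorem exists_dihedral_form [IsAlgClosed k] [CharZero k] (K : Subgroup (GL (Fin 2) k)) [Finite K]
    {η : kˣ} (h : ScalarsGenBy K η) {ν : ℕ} (hν : 2 ≤ ν) (e : K.map mk ≃* DihedralGroup ν) :
    ∃ (P : GL (Fin 2) k) (α ε θ : kˣ), DihedralForm (conjGL P K) ν η α ε θ := by
  obtain ⟨a, s, hp, ho⟩ : ∃ a s, DihedralPair (K.map mk) a s ∧ a ∈ K.map mk ∧ s ∈ K.map mk ∧
      orderOf a = ν := by
    let φ : DihedralGroup ν →* PGL(2, k) := (K.map mk).subtype.comp e.symm.toMonoidHom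
    have hφ : Function.Injective φ := (K.map mk).subtype_injective.comp e.symm.injective
    refine ⟨φ (.r 1), φ (.sr 0), ?_, (e.symm _).2, (e.symm _).2, ?_⟩
    · have := (dihedralPair_r_sr ν).map φ hφ
      have hr : (⊤ : Subgroup (DihedralGroup ν)).map φ = K.map mk := by
        rw [← Subgroup.map_map, Subgroup.map_top_of_surjective _ e.symm.surjective,
          ← MonoidHom.range_eq_map, Subgroup.range_subtype]
      rwa [hr] at this
    · rw [orderOf_injective φ hφ, DihedralGroup.orderOf_r_one]
  obtain ⟨⟨A, hA, rfl⟩, ⟨S, hS, rfl⟩, ho⟩ := ho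
  obtain ⟨P, α, ε, hP⟩ := exists_isDiag_conj hA
  have hord : orderOf ε = ν := by
    rw [← ho, ← orderOf_mk_diag2 α ε, ← hP]
    simp only [map_mul, map_inv]
    exact (MulAut.conj (mk P)).orderOf_eq (mk A)
  have hmap : ∀ (Q : GL (Fin 2) k) (L : Subgroup (GL (Fin 2) k)), (conjGL Q L).map mk =
      (L.map mk).map (MulAut.conj (mk Q)).toMonoidHom := by
    intro Q L
    rw [conjGL, Subgroup.map_map, Subgroup.map_map]
    congr 1
  have hp1 := hp.map (MulAut.conj (mk P)).toMonoidHom (MulAut.conj (mk P)).injective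
  have e1 : ∀ B Q : GL (Fin 2) k, (MulAut.conj (mk Q)).toMonoidHom (mk B) = mk (Q * B * Q⁻¹) :=
    fun B Q => by simp
  rw [← hmap, e1, e1, hP] at hp1
  have hS1 : P * S * P⁻¹ ∈ conjGL P K := ⟨S, hS, rfl⟩
  have hD1 : diag2 (α * ε) α ∈ conjGL P K := ⟨A, hA, hP⟩
  obtain ⟨q, t, hqt⟩ := exists_eq_diag2_mul_swap2 (by
    rintro rfl
    rw [orderOf_one] at hord
    omega) hp1.notMem hp1.sq hp1.rel
  rw [hqt] at hS1 hp1
  obtain ⟨x, θ, hθ, hθK, hmk⟩ := exists_rescale (h.conj P) hS1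
  have hp2 := hp1.map (MulAut.conj (mk (diag2 x 1))).toMonoidHom (MulAut.conj _).injective
  -- The rescaling is diagonal, so it leaves the diagonalised rotation unchanged.
  have hDD : diag2 x 1 * diag2 (α * ε) α * (diag2 x 1)⁻¹ = diag2 (α * ε) α := by
    rw [diag2_inv, diag2_mul, diag2_mul]
    simp [mul_comm]
  rw [← hmap, e1, e1, ← hmk, hDD] at hp2
  refine ⟨diag2 x 1 * P, α, ε, θ, ?_⟩
  rw [← conjGL_conjGL, ← hord]
  refine dihedralForm_of_mem ((h.conj P).conj _) (hord ▸ hν) ⟨_, hD1, hDD⟩ hθK hθ fun B hB => ?_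
  rw [map_mul, map_inv]
  exact hp2.cover _ ⟨B, hB, rfl⟩

end PlaneGroups

/-! ### From groups of `2 × 2` matrices to groups of plane projectivities -/

namespace PlaneGroups
open Matrix.ProjGenLinGroup

variable {k : Type*} [Field k]

variable (k) in
/-- The embedding of `GL(2,k)` into `GL(3,k)` with upper left block `A` and lower right entry
`1`. -/
def blockEmbed : GL (Fin 2) k →* GL (Fin 3) k where
  toFun A :=
    { val := !![A.1 0 0, A.1 0 1, 0; A.1 1 0, A.1 1 1, 0; 0, 0, 1]
      inv := !![(A⁻¹).1 0 0, (A⁻¹).1 0 1, 0; (A⁻¹).1 1 0, (A⁻¹).1 1 1, 0; 0, 0, 1]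
      val_inv := by
        have hm : A.1 * (A⁻¹).1 = 1 := by rw [← Units.val_mul, mul_inv_cancel]; rfl
        generalize (A⁻¹).1 = B at hm
        generalize A.1 = A at hm
        have h := fun i j => congrFun (congrFun hm i) j
        simp only [Matrix.mul_apply, Fin.sum_univ_two] at h
        ext i j
        fin_cases i <;> fin_cases j <;>
          simp [Matrix.mul_apply, Fin.sum_univ_three, h]
      inv_val := by
        have hm : (A⁻¹).1 * A.1 = 1 := by rw [← Units.val_mul, inv_mul_cancel]; rfl
        generalize (A⁻¹).1 = B at hm
        generalize A.1 = A at hm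
        have h := fun i j => congrFun (congrFun hm i) j
        simp only [Matrix.mul_apply, Fin.sum_univ_two] at h
        ext i j
        fin_cases i <;> fin_cases j <;>
          simp [Matrix.mul_apply, Fin.sum_univ_three, h] }
  map_one' := by
    ext i j
    fin_cases i <;> fin_cases j <;> simp
  map_mul' A B := by
    ext i j
    fin_cases i <;> fin_cases j <;>
      simp [Matrix.mul_apply, Fin.sum_univ_three, Fin.sum_univ_two]

theorem coe_blockEmbed (A : GL (Fin 2) k) :
    (blockEmbed k A).1 = !![A.1 0 0, A.1 0 1, 0; A.1 1 0, A.1 1 1, 0; 0, 0, 1] := rfl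

variable (k) in
/-- `blockEmbed` as a homomorphism into the matrices fixing `[0,0,1]`. -/
def blockEmbedFix : GL (Fin 2) k →* GLfix k :=
  (blockEmbed k).codRestrict (GLfix k) fun A => mem_GLfix.2 (by simp [coe_blockEmbed])

theorem blockHom_blockEmbedFix (A : GL (Fin 2) k) : blockHom (blockEmbedFix k A) = A := by
  ext i j
  change (blockEmbed k A).1 i.castSucc j.castSucc = _
  rw [coe_blockEmbed]
  fin_cases i <;> fin_cases j <;> simp

theorem blockEmbedFix_blockHom {A : GLfix k} (h0 : A.1.1 2 0 = 0) (h1 : A.1.1 2 1 = 0) :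
    blockEmbedFix k (blockHom A) = A := by
  have h := mem_GLfix.1 A.2
  apply Subtype.ext
  ext i j
  change (blockEmbed k (blockHom A)).1 i j = _
  rw [coe_blockEmbed]
  fin_cases i <;> fin_cases j <;> simp [blockHom, h0, h1, h]

theorem psi_comp_blockEmbedFix : psi.comp (blockEmbedFix k) = mk := by
  ext A
  change mk (blockHom (blockEmbedFix k A)) = mk A
  rw [blockHom_blockEmbedFix]

theorem blockEmbedFix_injective : Function.Injective (blockEmbedFix k) :=
  Function.LeftInverse.injective blockHom_blockEmbedFix

theorem blockEmbed_injective : Function.Injective (blockEmbed k) :=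
  Subtype.val_injective.comp (blockEmbedFix_injective (k := k))

theorem map_subtype_map_blockEmbedFix (K : Subgroup (GL (Fin 2) k)) :
    (K.map (blockEmbedFix k)).map (GLfix k).subtype = K.map (blockEmbed k) := by
  rw [Subgroup.map_map]
  rfl

theorem blockEmbed_diag2 (a b : kˣ) : blockEmbed k (diag2 a b) = diagM a b := by
  ext i j
  fin_cases i <;> fin_cases j <;> simp [coe_blockEmbed, coe_diag2, diagM]

theorem blockEmbed_swap2 (t : kˣ) : blockEmbed k (swap2 t) = swapM t := by
  ext i j
  fin_cases i <;> fin_cases j <;> simp [coe_blockEmbed, coe_swap2, swapM]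

theorem map_blockEmbed_closure (α ε η : kˣ) :
    (Subgroup.closure {diag2 (α * ε) α, diag2 η η}).map (blockEmbed k) = diagGroup α ε η := by
  rw [MonoidHom.map_closure, Set.image_pair, blockEmbed_diag2, blockEmbed_diag2, diagGroup]

/-- The group of projectivities defined by a group of matrices fixing `[0,0,1]`. -/
def ofGLfix (M : Subgroup (GLfix k)) : Subgroup PGL(3, k) :=
  (M.map tauInv).map (PGLfix k).subtype

theorem ofGLfix_le (M : Subgroup (GLfix k)) : ofGLfix M ≤ PGLfix k :=
  Subgroup.map_subtype_le _

theorem tau_tauInv (A : GLfix k) : tau (tauInv A) = A :=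
  (MulEquiv.ofBijective tauInv tauInv_bijective).symm_apply_apply A

theorem tauInv_tau (g : PGLfix k) : tauInv (tau g) = g :=
  (MulEquiv.ofBijective tauInv tauInv_bijective).apply_symm_apply g

theorem lift_ofGLfix (M : Subgroup (GLfix k)) : lift (ofGLfix M) = M := by
  rw [lift, ofGLfix, Subgroup.subgroupOf, Subgroup.comap_map_eq_self_of_injective
    (PGLfix k).subtype_injective, Subgroup.map_map]
  convert Subgroup.map_id M
  ext A : 1
  exact tau_tauInv A

theorem ofGLfix_lift {G : Subgroup PGL(3, k)} (hG : G ≤ PGLfix k) : ofGLfix (lift G) = G := by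
  rw [lift, ofGLfix, Subgroup.map_map (G.subgroupOf _)]
  have : (tauInv (k := k)).comp tau.toMonoidHom = .id _ := MonoidHom.ext tauInv_tau
  rw [this, Subgroup.map_id, Subgroup.subgroupOf_map_subtype, inf_eq_left.2 hG]

theorem conj_ofGLfix (C : GLfix k) (M : Subgroup (GLfix k)) :
    conj (tauInv C).1 (ofGLfix M) = ofGLfix (M.map (MulAut.conj C).toMonoidHom) := by
  rw [conj, ofGLfix, ofGLfix, Subgroup.map_map, Subgroup.map_map, Subgroup.map_map,
    Subgroup.map_map]
  congr 1

theorem natCard_ofGLfix (M : Subgroup (GLfix k)) : Nat.card (ofGLfix M) = Nat.card M := by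
  rw [ofGLfix, Subgroup.card_map_of_injective (PGLfix k).subtype_injective,
    Subgroup.card_map_of_injective tauInv_bijective.1]

/-- Transfers the shape of `K` along the injective block embedding. The dihedral and cyclic shapes
are assumed only for the type of image that occurs. -/
theorem normalForm_of_GL2 {K : Subgroup (GL (Fin 2) k)} [Finite K] {η : kˣ}
    (h : ScalarsGenBy K η)
    (himg : Nonempty (K.map mk ≃* alternatingGroup (Fin 5)) ∨
      Nonempty (K.map mk ≃* Equiv.Perm (Fin 4)) ∨
      Nonempty (K.map mk ≃* alternatingGroup (Fin 4)) ∨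
      (∃ ν : ℕ, 2 ≤ ν ∧ Nonempty (K.map mk ≃* DihedralGroup ν)) ∨ IsCyclic (K.map mk))
    (hd : ∀ ν : ℕ, 2 ≤ ν → Nonempty (K.map mk ≃* DihedralGroup ν) →
      ∃ α ε θ : kˣ, DihedralForm K ν η α ε θ)
    (hc : IsCyclic (K.map mk) → ∀ ε : kˣ, orderOf ε = Nat.card (K.map mk) →
      ∃ α : kˣ, α ^ orderOf ε ∈ Subgroup.zpowers η ∧
        K = Subgroup.closure {diag2 (α * ε) α, diag2 η η}) :
    NormalForm (ofGLfix (K.map (blockEmbedFix k))) η := by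
  have hfin : Finite (K.map mk) := Set.Finite.image mk (Set.toFinite (K : Set (GL (Fin 2) k)))
  have himage : image (ofGLfix (K.map (blockEmbedFix k))) = K.map mk := by
    rw [image, lift_ofGLfix, Subgroup.map_map, psi_comp_blockEmbedFix]
  have hlift : (lift (ofGLfix (K.map (blockEmbedFix k)))).map (GLfix k).subtype =
      K.map (blockEmbed k) := by
    rw [lift_ofGLfix, map_subtype_map_blockEmbedFix]
  have hker : (kerPart (ofGLfix (K.map (blockEmbedFix k)))).map (GLfix k).subtype =
      Subgroup.zpowers (diagM η η) := by
    have : K.map (blockEmbedFix k) ⊓ psi.ker = (K ⊓ mk.ker).map (blockEmbedFix k) := by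
      rw [← psi_comp_blockEmbedFix, ← MonoidHom.comap_ker]
      ext A
      constructor
      · rintro ⟨⟨B, hB, rfl⟩, hA⟩
        exact ⟨B, ⟨hB, hA⟩, rfl⟩
      · rintro ⟨B, ⟨hB, hA⟩, rfl⟩
        exact ⟨⟨B, hB, rfl⟩, hA⟩
    rw [kerPart, lift_ofGLfix, this, map_subtype_map_blockEmbedFix, h.inf_ker,
      MonoidHom.map_zpowers, blockEmbed_diag2]
  have hkercard : Nat.card (kerPart (ofGLfix (K.map (blockEmbedFix k)))) = orderOf η := by
    rw [← Subgroup.card_map_of_injective (GLfix k).subtype_injective, hker, Nat.card_zpowers,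
      ← blockEmbed_diag2, orderOf_injective _ blockEmbed_injective]
    refine orderOf_eq_orderOf_iff.2 fun n => ?_
    rw [diag2_pow, ← map_one (diag2Hom k)]
    exact diag2_inj.trans ⟨fun h => h.1, fun h => ⟨h, h⟩⟩
  have hcard : Nat.card (ofGLfix (K.map (blockEmbedFix k))) = Nat.card K := by
    rw [natCard_ofGLfix, Subgroup.card_map_of_injective blockEmbedFix_injective]
  constructor
  · exact ofGLfix_le _
  · exact hker
  · rw [himage, hcard, h.card_eq]
  · rw [himage]
    refine himg.imp_right (.imp_right (.imp_right (.imp_right fun hcyc => ?_)))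
    exact ⟨Nat.card (K.map mk), Nat.card_pos, ⟨(zmodCyclicMulEquiv hcyc).symm⟩⟩
  · rw [himage, hkercard, hcard, ← h.card_eq]
    intro hH n hn hle
    have hH' : Nat.card (K.map mk) ≤ 60 := by
      rcases hH with ⟨⟨e⟩⟩ | ⟨⟨e⟩⟩ | ⟨⟨e⟩⟩
      · have := two_mul_nat_card_alternatingGroup (α := Fin 5)
        rw [Nat.card_congr e.toEquiv]
        rw [Nat.card_perm, Nat.card_fin, show Nat.factorial 5 = 120 from rfl] at this
        omega
      · rw [Nat.card_congr e.toEquiv, Nat.card_perm, Nat.card_fin]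
        decide
      · have := two_mul_nat_card_alternatingGroup (α := Fin 4)
        rw [Nat.card_congr e.toEquiv]
        rw [Nat.card_perm, Nat.card_fin, show Nat.factorial 4 = 24 from rfl] at this
        omega
    -- If `|G''| ≤ n`, then `6n² ≤ |G| = |G''| |H| ≤ 60n`, so `n ≤ 10`.
    by_contra! hlt
    have h1 := Nat.mul_le_mul hlt hH'
    nlinarith
  · rw [himage, hlift, hkercard]
    intro ν hν hiso
    obtain ⟨α, ε, θ, hf⟩ := hd ν hν hiso
    have himg2 : (blockEmbed k) ''
        ((fun x => x * swap2 θ) '' Subgroup.closure {diag2 (α * ε) α, diag2 η η}) =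
        (fun x => x * swapM θ) '' diagGroup α ε η := by
      rw [← map_blockEmbed_closure, Subgroup.coe_map, Set.image_image, Set.image_image]
      simp only [map_mul, blockEmbed_swap2]
    refine ⟨α, ε, θ, ?_, hf.theta, hf.order, rfl, hf.pow_mem, hf.sq_mem, hf.trivial, ?_, ?_, ?_⟩
    · conv_lhs => rw [hf.eq_closure]
      rw [MonoidHom.map_closure, Set.image_insert_eq, Set.image_pair, blockEmbed_diag2,
        blockEmbed_diag2, blockEmbed_swap2]
    · rw [Subgroup.coe_map, hf.union, Set.image_union, himg2, ← map_blockEmbed_closure,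
        Subgroup.coe_map]
    · rw [← himg2, ← map_blockEmbed_closure, Subgroup.coe_map,
        Set.disjoint_image_iff blockEmbed_injective]
      exact hf.disj
    · rw [← map_blockEmbed_closure, Subgroup.card_map_of_injective blockEmbed_injective, hf.card]
  · rw [himage, hlift, hkercard]
    rintro ν hν ⟨e⟩ ε hε
    have hcyc : IsCyclic (K.map mk) := isCyclic_of_surjective e.symm e.symm.surjective
    have : NeZero ν := ⟨by omega⟩
    have hcν : Nat.card (K.map mk) = ν := by
      rw [Nat.card_congr e.toEquiv]
      exact Nat.card_zmod ν
    obtain ⟨α, h1, h2⟩ := hc hcyc ε (hε.trans hcν.symm)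
    refine ⟨α, hε ▸ h1, ?_, ?_⟩
    · conv_lhs => rw [h2]
      exact map_blockEmbed_closure _ _ _
    · rw [lift_ofGLfix, Subgroup.card_map_of_injective blockEmbedFix_injective, ← h.card_eq, hcν,
        mul_comm]

end PlaneGroups

/-! ### Complete reducibility and the normal form -/

namespace PlaneGroups
open Matrix.ProjGenLinGroup

variable {k : Type*} [Field k]

/-- The matrix with rows `(1,0,0)`, `(0,1,0)`, `(u,v,1)`, fixing `[0,0,1]`. -/
def shear (u v : k) : GLfix k :=
  ⟨Matrix.GeneralLinearGroup.mkOfDetNeZero !![1, 0, 0; 0, 1, 0; u, v, 1]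
    (by simp [Matrix.det_fin_three]), mem_GLfix.2 (by
      simp [Matrix.GeneralLinearGroup.mkOfDetNeZero])⟩

theorem coe_shear (u v : k) : (shear u v).1.1 = !![1, 0, 0; 0, 1, 0; u, v, 1] := rfl

theorem exists_invariant_row [CharZero k] (M : Subgroup (GLfix k)) [Finite M] :
    ∃ φ : Fin 3 → k, φ 2 = 1 ∧ ∀ B ∈ M, Matrix.vecMul φ B.1.1 = φ := by
  have := Fintype.ofFinite M
  have hcard : (Fintype.card M : k) ≠ 0 := by exact_mod_cast Fintype.card_ne_zero
  -- The mean of the third rows. Multiplying the third row of `A` by `B` gives that of `A * B`, so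
  -- right translation permutes the summands; the last coordinate stays 1 because it is 1 in each of
  -- them.
  refine ⟨(Fintype.card M : k)⁻¹ • ∑ A : M, A.1.1.1 2, ?_, fun B hB => ?_⟩
  · have : ∀ A : M, A.1.1.1 2 2 = 1 := fun A => (mem_GLfix.1 A.1.2).2.2
    simp [this, hcard]
  · rw [Matrix.smul_vecMul, Matrix.sum_vecMul]
    congr 1
    refine Fintype.sum_equiv (Equiv.mulRight (⟨B, hB⟩ : M)) _ _ fun A => ?_
    rfl

theorem exists_conj_eq_map_blockEmbedFix [CharZero k] (M : Subgroup (GLfix k)) [Finite M] :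
    ∃ (C : GLfix k) (K : Subgroup (GL (Fin 2) k)), Finite K ∧
      M.map (MulAut.conj C).toMonoidHom = K.map (blockEmbedFix k) := by
  obtain ⟨φ, hφ2, hφ⟩ := exists_invariant_row M
  -- The third row of `C` is `φ`, so conjugation by `C` turns the invariant row `φ` into `(0,0,1)`.
  let C := shear (φ 0) (φ 1)
  have hC : Matrix.vecMul (Pi.single 2 1) C.1.1 = φ := by
    rw [Matrix.single_one_vecMul, coe_shear]
    funext j
    fin_cases j <;> simp [hφ2]
  have hC' : Matrix.vecMul φ (C⁻¹).1.1 = Pi.single 2 1 := by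
    rw [← hC, Matrix.vecMul_vecMul, ← Units.val_mul, ← Subgroup.coe_mul, mul_inv_cancel]
    simp
  have hrow : ∀ B ∈ M, (C * B * C⁻¹).1.1 2 = Pi.single 2 1 := by
    intro B hB
    refine (Matrix.single_one_vecMul _ _).symm.trans ?_
    rw [Subgroup.coe_mul, Subgroup.coe_mul, Units.val_mul,
      Units.val_mul, ← Matrix.vecMul_vecMul, ← Matrix.vecMul_vecMul, hC, hφ B hB, hC']
  refine ⟨C, (M.map (MulAut.conj C).toMonoidHom).map blockHom, ?_, ?_⟩
  · exact Set.Finite.image _ (Set.Finite.image _ (Set.toFinite (M : Set (GLfix k))))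
  · rw [Subgroup.map_map]
    refine (Subgroup.map_id _).symm.trans ?_
    ext A
    constructor
    · rintro ⟨_, ⟨B, hB, rfl⟩, rfl⟩
      refine ⟨_, ⟨B, hB, rfl⟩, ?_⟩
      exact blockEmbedFix_blockHom ((congrFun (hrow B hB) 0).trans (by simp))
        ((congrFun (hrow B hB) 1).trans (by simp))
    · rintro ⟨_, ⟨B, hB, rfl⟩, rfl⟩
      refine ⟨_, ⟨B, hB, rfl⟩, ?_⟩
      exact (blockEmbedFix_blockHom ((congrFun (hrow B hB) 0).trans (by simp))
        ((congrFun (hrow B hB) 1).trans (by simp))).symm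

/-- The conjugating matrix depends on the type of the image. The types do not interfere:
`DihedralGroup ν` with `ν ≥ 2` is not cyclic, and its order determines `ν`. -/
theorem exists_conj_normalForm_GL2 [IsAlgClosed k] [CharZero k] (K : Subgroup (GL (Fin 2) k))
    [Finite K] : ∃ (P : GL (Fin 2) k) (η : kˣ),
      NormalForm (ofGLfix ((conjGL P K).map (blockEmbedFix k))) η := by
  obtain ⟨η, h⟩ := exists_scalarsGenBy K
  have hfin : ∀ P, Finite (conjGL P K) := fun P =>
    Set.Finite.image _ (Set.toFinite (K : Set (GL (Fin 2) k)))
  have hfin2 : ∀ P, Finite ((conjGL P K).map mk) := fun P =>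
    Set.Finite.image _ (Set.Finite.image _ (Set.toFinite (K : Set (GL (Fin 2) k))))
  have iso : ∀ P, Nonempty ((conjGL P K).map mk ≃* K.map mk) := by
    intro P
    have e : (conjGL P K).map mk = (K.map mk).map (MulAut.conj (mk P)).toMonoidHom := by
      rw [conjGL, Subgroup.map_map, Subgroup.map_map]
      congr 1
    rw [e]
    exact ⟨(Subgroup.equivMapOfInjective _ _ (MulAut.conj (mk P)).injective).symm⟩
  by_cases hc : IsCyclic (K.map mk)
  · obtain ⟨P, hP⟩ := exists_cyclic_form K h hc
    obtain ⟨e⟩ := iso P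
    refine ⟨P, η, normalForm_of_GL2 (h.conj P) (classification_PGL2 _) ?_ ?_⟩
    · rintro ν hν ⟨e'⟩
      have := isCyclic_of_surjective (e.symm.trans e') (e.symm.trans e').surjective
      rw [DihedralGroup.isCyclic_iff] at this
      omega
    · intro _ ε hε
      exact hP ε (hε.trans (Nat.card_congr e.toEquiv))
  by_cases hd : ∃ ν : ℕ, 2 ≤ ν ∧ Nonempty (K.map mk ≃* DihedralGroup ν)
  · obtain ⟨ν, hν, ⟨e⟩⟩ := hd
    obtain ⟨P, hP⟩ := exists_dihedral_form K h hν e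
    obtain ⟨e'⟩ := iso P
    refine ⟨P, η, normalForm_of_GL2 (h.conj P) (classification_PGL2 _) ?_ ?_⟩
    · rintro ν' hν' ⟨f⟩
      have := Nat.card_congr ((e'.symm.trans f).symm.trans e).toEquiv
      rw [DihedralGroup.nat_card, DihedralGroup.nat_card] at this
      obtain rfl : ν' = ν := by omega
      exact hP
    · intro hcyc
      exact absurd (isCyclic_of_surjective e' e'.surjective) hc
  · obtain ⟨e⟩ := iso 1
    refine ⟨1, η, normalForm_of_GL2 (h.conj 1) (classification_PGL2 _) ?_ ?_⟩
    · rintro ν hν ⟨f⟩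
      exact absurd ⟨ν, hν, ⟨e.symm.trans f⟩⟩ hd
    · intro hcyc
      exact absurd (isCyclic_of_surjective e e.surjective) hc

theorem exists_conj_normalForm [IsAlgClosed k] [CharZero k] (G : Subgroup PGL(3, k)) [Finite G]
    (hG : G ≤ PGLfix k) : ∃ g ∈ PGLfix k, ∃ η : kˣ, NormalForm (conj g G) η := by
  have hfin : Finite (lift G) := by
    apply Nat.finite_of_card_ne_zero
    rw [← natCard_ofGLfix, ofGLfix_lift hG]
    exact Nat.card_pos.ne'
  obtain ⟨C, K, hK, hCK⟩ := exists_conj_eq_map_blockEmbedFix (lift G)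
  obtain ⟨P, η, hP⟩ := exists_conj_normalForm_GL2 K
  refine ⟨(tauInv (blockEmbedFix k P * C)).1, (tauInv (blockEmbedFix k P * C)).2, η, ?_⟩
  have : (lift G).map (MulAut.conj (blockEmbedFix k P * C)).toMonoidHom =
      (conjGL P K).map (blockEmbedFix k) := by
    have e1 : (conjGL P K).map (blockEmbedFix k) =
        (K.map (blockEmbedFix k)).map (MulAut.conj (blockEmbedFix k P)).toMonoidHom := by
      rw [conjGL, Subgroup.map_map, Subgroup.map_map]
      congr 1
      ext1 A
      simp
    rw [e1, ← hCK, Subgroup.map_map]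
    congr 1
    rw [map_mul]
    rfl
  rw [← this, ← conj_ofGLfix, ofGLfix_lift hG] at hP
  exact hP

/-! ### Duality between the point `(0,0,1)` and the line `z = 0` -/

section Transpose

theorem transposeM_mul (A B : GL (Fin 3) k) :
    transposeM (A * B) = transposeM B * transposeM A :=
  Units.ext (Matrix.transpose_mul _ _)

theorem transposeM_transposeM (A : GL (Fin 3) k) : transposeM (transposeM A) = A :=
  Units.ext (Matrix.transpose_transpose _)

theorem transposeM_scalar (u : kˣ) :
    transposeM (Matrix.GeneralLinearGroup.scalar (Fin 3) u) =
      Matrix.GeneralLinearGroup.scalar (Fin 3) u := by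
  ext i j
  simp [transposeM, Matrix.GeneralLinearGroup.scalar, Matrix.diagonal, eq_comm]

variable (k) in
/-- The automorphism `(A) ↦ (ᵗA)⁻¹` of `PGL(3,k)`. -/
def contragredient : PGL(3, k) →* PGL(3, k) :=
  Matrix.ProjGenLinGroup.lift
    (MonoidHom.mk' (fun A => (mk (transposeM A))⁻¹) fun A B => by
      rw [transposeM_mul, map_mul, mul_inv_rev])
    (by
      ext1 u
      change (mk (transposeM _))⁻¹ = 1
      rw [transposeM_scalar, mk_scalar, inv_one])

theorem contragredient_mk (A : GL (Fin 3) k) :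
    contragredient k (mk A) = (mk (transposeM A))⁻¹ := rfl

theorem contragredient_contragredient (p : PGL(3, k)) :
    contragredient k (contragredient k p) = p := by
  obtain ⟨A, rfl⟩ := mk_surjective p
  rw [contragredient_mk, map_inv, contragredient_mk, transposeM_transposeM, inv_inv]

/-- A subgroup is closed under inverses, so transpose and inverse transpose have the same preimage
of it. -/
theorem transposeSet_eq (G : Subgroup PGL(3, k)) :
    transposeSet G = (G.comap (contragredient k) : Set PGL(3, k)) := by
  ext p
  constructor
  · rintro ⟨B, rfl, hB⟩
    exact G.inv_mem hB
  · intro hp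
    obtain ⟨B, rfl⟩ := mk_surjective p
    exact ⟨B, rfl, G.inv_mem_iff.1 hp⟩

theorem mk_mem_lineZ_iff {v : Fin 3 → k} (hv : v ≠ 0) :
    Projectivization.mk k v hv ∈ lineZ k ↔ v 2 = 0 := by
  change (∀ w ∈ (Projectivization.mk k v hv).submodule, w 2 = 0) ↔ _
  rw [Projectivization.submodule_mk]
  constructor
  · intro h
    exact h v (Submodule.mem_span_singleton_self v)
  · intro h w hw
    obtain ⟨c, rfl⟩ := Submodule.mem_span_singleton.1 hw
    simp [h]

/-- Invariance of the line kills the first two entries of the third row, so the third column of the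
transpose is a multiple of `[0,0,1]`. -/
theorem contragredient_mem_PGLfix {p : PGL(3, k)}
    (hp : (fun x => p • x) '' lineZ k = lineZ k) : contragredient k p ∈ PGLfix k := by
  obtain ⟨A, rfl⟩ := mk_surjective p
  have key : ∀ v : Fin 3 → k, v ≠ 0 → v 2 = 0 → A.1.mulVec v 2 = 0 := by
    intro v hv h
    have : mk A • Projectivization.mk k v hv ∈ lineZ k :=
      hp ▸ Set.mem_image_of_mem _ ((mk_mem_lineZ_iff hv).2 h)
    rw [Projectivization.PGL.mk_smul_mk, mk_mem_lineZ_iff] at this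
    exact this
  have h0 : A.1 2 0 = 0 := by
    simpa using key (Pi.single 0 1) (by simp) (by simp)
  have h1 : A.1 2 1 = 0 := by
    simpa using key (Pi.single 1 1) (by simp) (by simp)
  have h2 : A.1 2 2 ≠ 0 := by
    intro h2
    have hdet : A.1.det ≠ 0 := A.det.ne_zero
    exact hdet (Matrix.det_eq_zero_of_row_eq_zero 2 fun j => by fin_cases j <;> assumption)
  rw [contragredient_mk]
  refine inv_mem (mk_mem_PGLfix_iff.2 ⟨Units.mk0 _ h2, ?_⟩)
  rw [Units.smul_def, Units.smul_def, Matrix.smul_eq_mulVec]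
  funext i
  fin_cases i <;>
    simp [transposeM, Matrix.mulVec, dotProduct, Fin.sum_univ_three, h0, h1]

/-- The contragredient image of `G` fixes the point, and part (a) puts it into normal form. Since
the contragredient is an involution, applying it again turns conjugation by `g` into conjugation by
`contragredient k g`. -/
theorem exists_conj_eq_transposeSet [IsAlgClosed k] [CharZero k] (G : Subgroup PGL(3, k)) [Finite G]
    (hG : ∀ g ∈ G, (fun p => g • p) '' lineZ k = lineZ k) :
    ∃ (g : PGL(3, k)) (G' : Subgroup PGL(3, k)) (η : kˣ), Finite G' ∧ G' ≤ PGLfix k ∧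
      NormalForm G' η ∧ (conj g G : Set PGL(3, k)) = transposeSet G' := by
  have hfin : Finite (G.map (contragredient k)) :=
    Set.Finite.image _ (Set.toFinite (G : Set PGL(3, k)))
  have hle : G.map (contragredient k) ≤ PGLfix k := by
    rintro _ ⟨p, hp, rfl⟩
    exact contragredient_mem_PGLfix (hG p hp)
  obtain ⟨g, -, η, h⟩ := exists_conj_normalForm _ hle
  refine ⟨contragredient k g, conj g (G.map (contragredient k)), η,
    Set.Finite.image _ (Set.toFinite (G.map (contragredient k) : Set PGL(3, k))),
    h.fixes, h, ?_⟩
  rw [transposeSet_eq]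
  ext p
  constructor
  · rintro ⟨q, hq, rfl⟩
    refine ⟨contragredient k q, ⟨q, hq, rfl⟩, ?_⟩
    simp [contragredient_contragredient]
  · rintro ⟨_, ⟨q, hq, rfl⟩, hp⟩
    refine ⟨q, hq, ?_⟩
    have := congrArg (contragredient k) hp
    rw [contragredient_contragredient] at this
    rw [← this]
    simp [contragredient_contragredient]

end Transpose

end PlaneGroups

theorem proposition2p1 (k : Type*) [Field k] [IsAlgClosed k] [CharZero k] :
    (∀ G₀ : Subgroup PGL(3, k), Finite G₀ → G₀ ≤ PlaneGroups.PGLfix k →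
      ∃ g ∈ PlaneGroups.PGLfix k, ∃ η : kˣ, PlaneGroups.NormalForm (PlaneGroups.conj g G₀) η) ∧
    (∀ Gt : Subgroup PGL(3, k), Finite Gt →
      (∀ g ∈ Gt, (fun p => g • p) '' PlaneGroups.lineZ k = PlaneGroups.lineZ k) →
      ∃ (g : PGL(3, k)) (G : Subgroup PGL(3, k)) (η : kˣ),
        Finite G ∧ G ≤ PlaneGroups.PGLfix k ∧ PlaneGroups.NormalForm G η ∧
        (PlaneGroups.conj g Gt : Set PGL(3, k)) = PlaneGroups.transposeSet G) :=
  ⟨fun G₀ _ hG => PlaneGroups.exists_conj_normalForm G₀ hG,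
    fun Gt _ hG => PlaneGroups.exists_conj_eq_transposeSet Gt hG⟩
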